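/- **Problem.** Let $f:\mathbb R^n\to\mathbb R$ and $c:\mathbb R^n\to\mathbb R^m$ be twice continuously differentiable and consider $\min f(x)$ subject to $c(x)=0$, $x\ge 0$. Write $g=\nabla f$, $J$ for the Jacobian of $c$, and $H(x,y)=\nabla^2 f(x)-\sum_i y_i\nabla^2c_i(x)$. **Direction of negative curvature.** Fix constants $\theta\in[0,1)$ and $\Lambda$. Given $v=(x,y)$, $\mu>0$ and a tolerance $t>0$, let $\mathcal W=\{i: x_i\le t\}$, let $F$ be the complement of $\mathcal W$, and let $$K=\begin{pmatrix}H_F&J_F^T\\ J_F&-\mu I_m\end{pmatrix},$$ where $H_F$ is the submatrix of $H(x,y)$ with rows and columns in $F$ and $J_F$ consists of the columns of $J(x)$ in $F$. Perform a partial $LBL^T$ factorization of $K$ by successive pivots, each of which is a positive diagonal entry in an $H$-row of the current Schur complement, a negative diagonal entry in a $(-\mu I)$-row, or a $2\times2$ block formed by one $H$-row and one $(-\mu I)$-row with one positive and one negative eigenvalue. The pivots are chosen so that all entries of the unit lower triangular factor $L$ (extended by identity columns) are at most $\Lambda$ in absolute value. The process ends when all $(-\mu I)$-rows are eliminated and the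 remaining Schur complement $S$ satisfies $S_{ii}\le\theta\rho$ for all $i$, where $\rho=\max_{i,j}|S_{ij}|$. If $S$ is nonempty and $\rho=|S_{qr}|$, let $h=e_q$ if $q=r$ and $h=(e_q-\operatorname{sgn}(S_{qr})e_r)/\sqrt2$ otherwise, and solve $L^T\tilde u=\sqrt\rho\,h$ ($h$ being extended by zero); if $S$ is empty, put $\tilde u=0$. The direction $\hat u\in\mathbb R^n$ has as its $F$-components the corresponding components of $\tilde u$, and $\hat u_i=0$ for $i\in\mathcal W$. **S- and L-iterates.** Let $\eta(x)=\|c(x)\|$, $$\omega=\max\Big(\big\|\min(x,g(x)-J(x)^Ty)\big\|,\;-\frac{\hat u^T\big(H(x,y)+\frac1\mu J(x)^TJ(x)\big)\hat u}{\|\hat u\|^2}\Big)$$ (the quotient being $0$ if $\hat u=0$), $\phi_S=\eta+10^{-5}\omega$ and $\phi_L=10^{-5}\eta+\omega$. Let $v_k=(x_k,y_k)$ be the iterates of the modified pdSQP method, with parameters $\mu_k>0$, active-set tolerances $t_k>0$, $t_k\to0$, and directions $\hat u_k$ computed as above at $v_k$ with $\mu_k,t_k$ and with $\theta,\Lambda$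 independent of $k$. Let $\phi_S^{\max},\phi_L^{\max}$ be initially positive. For $k\ge1$, $v_k$ is an S-iterate if $\phi_S(v_k)\le\frac12\phi_S^{\max}$, and then $\phi_S^{\max}$ is halved; otherwise it is an L-iterate if $\phi_L(v_k)\le\frac12\phi_L^{\max}$, and then $\phi_L^{\max}$ is halved; in all other cases both values are kept. Nothing further is required of the method: the rules by which $v_{k+1}$ is computed from $v_k$ (QP step, step of negative curvature, line search) and by which $\mu_k$ is updated may be arbitrary. **Theorem.** Suppose that a subsequence of $(v_k)$ consisting of S- and L-iterates converges to $v^\star=(x^\star,y^\star)$, and that $v^\star$ satisfies the first-order KKT conditions $c(x^\star)=0$, $x^\star\ge0$, $z^\star:=g(x^\star)-J(x^\star)^Ty^\star\ge0$, $x^\star_iz^\star_i=0$ for all $i$. Let $\mathcal A=\{i:x^\star_i=0\}$ and let $E_{\mathcal A}$ consist of the columns $e_i$, $i\in\mathcal A$, of the identity. Suppose that at $x^\star$ * MFCQ holds: the rows of $J(x^\star)$ are linearly independent and there is $d$ with $J(x^\star)d=0$ and $d_i>0$ for all $i\in\mathcal A$; * the Weak Constant Rank condition holds: the rank of $\begin{pmatrix}J(z)\\E_{\mathcal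 A}^T\end{pmatrix}$ is constant for $z$ in a neighborhood of $x^\star$. Then $v^\star$ satisfies the second-order necessary optimality conditions: it is a KKT point, and $d^TH(x^\star,y^\star)d\ge0$ for every $d$ with $J(x^\star)d=0$ and $d_i=0$ for all $i\in\mathcal A$. -/

import Mathlib

open Filter Topology Matrix

noncomputable section

namespace PdSQP

/-- `ℝⁿ` with the Euclidean norm. -/
abbrev E (n : ℕ) : Type := EuclideanSpace ℝ (Fin n)

/-! ### The problem: minimize `f x` subject to `c x = 0`, `x ≥ 0` -/

/-- The Jacobian `J(x)` of the equality constraints. -/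
def jac {n m : ℕ} (c : E n → E m) (x : E n) : Matrix (Fin m) (Fin n) ℝ :=
  fun i j => (fderiv ℝ c x (EuclideanSpace.single j 1)) i

/-- The matrix of second partial derivatives of `φ` at `x`. -/
def hess {n : ℕ} (φ : E n → ℝ) (x : E n) : Matrix (Fin n) (Fin n) ℝ :=
  fun i j => fderiv ℝ (fderiv ℝ φ) x (EuclideanSpace.single i 1) (EuclideanSpace.single j 1)

/-- `H(x, y)`: the Hessian in `x` of the Lagrangian `f(x) - ∑ i, y i * c i (x)`. -/
def lagHess {n m : ℕ} (f : E n → ℝ) (c : E n → E m) (x : E n) (y : E m) :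
    Matrix (Fin n) (Fin n) ℝ :=
  hess (fun z => f z - ∑ i, y i * c z i) x

/-- The gradient of the Lagrangian, `g(x) - J(x)ᵀ y`. -/
def dualRes {n m : ℕ} (f : E n → ℝ) (c : E n → E m) (x : E n) (y : E m) : Fin n → ℝ :=
  fun i => gradient f x i - ((jac c x)ᵀ *ᵥ y.ofLp) i

/-- First-order KKT conditions at `(x, y)`. -/
def IsKKT {n m : ℕ} (f : E n → ℝ) (c : E n → E m) (x : E n) (y : E m) : Prop :=
  c x = 0 ∧ ∀ i, 0 ≤ x i ∧ 0 ≤ dualRes f c x y i ∧ x i * dualRes f c x y i = 0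

/-- The Mangasarian-Fromovitz constraint qualification at `x`. -/
def MFCQ {n m : ℕ} (c : E n → E m) (x : E n) : Prop :=
  LinearIndependent ℝ (fun i : Fin m => jac c x i) ∧
    ∃ d : Fin n → ℝ, jac c x *ᵥ d = 0 ∧ ∀ i, x i = 0 → 0 < d i

/-- The matrix with rows those of `J(z)` followed by `eᵢᵀ` for the indices `i` active at `x`. -/
def activeJac {n m : ℕ} (c : E n → E m) (x z : E n) :
    Matrix (Fin m ⊕ {i : Fin n // x i = 0}) (Fin n) ℝ :=
  Matrix.fromRows (jac c z) (fun a => Pi.single a.1 1)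

/-- Weak Constant Rank condition at `x`: the active set is that of `x`, only the Jacobian
is evaluated at the neighbouring points. -/
def WCR {n m : ℕ} (c : E n → E m) (x : E n) : Prop :=
  ∀ᶠ z in 𝓝 x, (activeJac c x z).rank = (activeJac c x x).rank

/-- Second-order necessary conditions at `(x, y)`: the KKT conditions, and the Hessian of the
Lagrangian is positive semidefinite on `T(x) = {d | J(x) d = 0, dᵢ = 0 whenever xᵢ = 0}`. -/
def SecondOrderNecessary {n m : ℕ} (f : E n → ℝ) (c : E n → E m) (x : E n) (y : E m) : Prop :=
  IsKKT f c x y ∧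
    ∀ d : Fin n → ℝ, jac c x *ᵥ d = 0 → (∀ i, x i = 0 → d i = 0) →
      0 ≤ d ⬝ᵥ (lagHess f c x y *ᵥ d)

/-! ### First stage of the inertia-controlling factorization -/

section Factorization

variable {α β : Type*} [Fintype α] [Fintype β] [DecidableEq α] [DecidableEq β]

/-- Schur complement after the `1 × 1` pivot `p`. Its row and column `p` vanish, so the matrix
still to be factorized is kept at full size, with zeros in the eliminated rows and columns. -/
def elim1 {ι : Type*} (A : Matrix ι ι ℝ) (p : ι) : Matrix ι ι ℝ :=
  fun r s => A r s - A r p * A p s / A p p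

/-- Determinant of the `2 × 2` pivot block with (symmetric) rows and columns `i`, `j`. -/
def pivDet {ι : Type*} (A : Matrix ι ι ℝ) (i j : ι) : ℝ :=
  A i i * A j j - A i j * A j i

/-- Multipliers of the `2 × 2` pivot `{i, j}` belonging to `i`: the `i`-th column of
`A_{·,{i,j}} (A_{{i,j},{i,j}})⁻¹`. -/
def mult2 {ι : Type*} (A : Matrix ι ι ℝ) (i j : ι) : ι → ℝ :=
  fun r => (A r i * A j j - A r j * A j i) / pivDet A i j

/-- Schur complement after the `2 × 2` pivot `{i, j}`. -/
def elim2 {ι : Type*} (A : Matrix ι ι ℝ) (i j : ι) : Matrix ι ι ℝ :=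
  fun r s => A r s - (mult2 A i j r * A i s + mult2 A j i r * A j s)

/-- `StageOne K R L A`: from the symmetric matrix `K` with rows `α` (the `H`-rows) and `β`
(the `D`-rows), a sequence of pivots of types `H⁺`, `D⁻`, `HD` has led to the factor `L` and to
the Schur complement `A` on the set `R` of remaining indices. Thus `K = L (B + A) Lᵀ`, where `B` is
block diagonal on the pivoted indices, `A` vanishes outside `R × R`, and `L` is, in the order of the
pivots, unit lower triangular, with the columns of the identity at the indices in `R`. -/
inductive StageOne (K : Matrix (α ⊕ β) (α ⊕ β) ℝ) :
    Finset (α ⊕ β) → Matrix (α ⊕ β) (α ⊕ β) ℝ → Matrix (α ⊕ β) (α ⊕ β) ℝ → Prop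
  | start : StageOne K Finset.univ 1 K
  | hplus (R : Finset (α ⊕ β)) (L A : Matrix (α ⊕ β) (α ⊕ β) ℝ) (i : α) :
      StageOne K R L A → Sum.inl i ∈ R → 0 < A (Sum.inl i) (Sum.inl i) →
      StageOne K (R.erase (Sum.inl i))
        (L.updateCol (Sum.inl i) (fun r => A r (Sum.inl i) / A (Sum.inl i) (Sum.inl i)))
        (elim1 A (Sum.inl i))
  | dminus (R : Finset (α ⊕ β)) (L A : Matrix (α ⊕ β) (α ⊕ β) ℝ) (j : β) :
      StageOne K R L A → Sum.inr j ∈ R → A (Sum.inr j) (Sum.inr j) < 0 →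
      StageOne K (R.erase (Sum.inr j))
        (L.updateCol (Sum.inr j) (fun r => A r (Sum.inr j) / A (Sum.inr j) (Sum.inr j)))
        (elim1 A (Sum.inr j))
  | hd (R : Finset (α ⊕ β)) (L A : Matrix (α ⊕ β) (α ⊕ β) ℝ) (i : α) (j : β) :
      StageOne K R L A → Sum.inl i ∈ R → Sum.inr j ∈ R →
      -- one positive and one negative eigenvalue
      pivDet A (Sum.inl i) (Sum.inr j) < 0 →
      StageOne K ((R.erase (Sum.inl i)).erase (Sum.inr j))
        ((L.updateCol (Sum.inl i) (mult2 A (Sum.inl i) (Sum.inr j))).updateCol (Sum.inr j)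
          (mult2 A (Sum.inr j) (Sum.inl i)))
        (elim2 A (Sum.inl i) (Sum.inr j))

/-- The vector `h`: `e_q` if `q = r`, and `(e_q - sgn(S_qr) e_r) / √2` otherwise. -/
def curvVec {ι : Type*} [DecidableEq ι] (S : Matrix ι ι ℝ) (q r : ι) : ι → ℝ :=
  if q = r then Pi.single q 1
  else (1 / √2) • (Pi.single q 1 - Real.sign (S q r) • Pi.single r 1)

/-- `u` is computed from a first-stage factorization of `K` as a direction of negative curvature.
The pivoting has multipliers bounded by `Λ`; it eliminates all of the `D`-rows and stops when
no `H⁺` pivot is left, the threshold being `θ` relative to the largest entry `ρ = |S_qr|` of the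
Schur complement `S` (every positive diagonal entry is a pivot if `θ = 0`). Then `Lᵀ u = √ρ h`.
In particular `u = 0` if `S` is empty or zero. -/
def IsCurvSolve (K : Matrix (α ⊕ β) (α ⊕ β) ℝ) (θ Λ : ℝ) (u : α ⊕ β → ℝ) : Prop :=
  ∃ (R : Finset (α ⊕ β)) (L S : Matrix (α ⊕ β) (α ⊕ β) ℝ),
    StageOne K R L S ∧ (∀ a b, |L a b| ≤ Λ) ∧ (∀ j : β, Sum.inr j ∉ R) ∧
    ((R = ∅ ∧ u = 0) ∨
      ∃ q ∈ R, ∃ r ∈ R, (∀ a ∈ R, ∀ b ∈ R, |S a b| ≤ |S q r|) ∧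
        (∀ a ∈ R, S a a ≤ θ * |S q r|) ∧
        Lᵀ *ᵥ u = √|S q r| • curvVec S q r)

end Factorization

/-! ### The second-order filter quantities -/

/-- The active-set estimate `𝒲 = {i | xᵢ ≤ t}` with tolerance `t`. -/
def workSet {n : ℕ} (t : ℝ) (x : E n) : Finset (Fin n) :=
  Finset.univ.filter (fun i => x i ≤ t)

/-- The estimated free variables. -/
abbrev Free {n : ℕ} (t : ℝ) (x : E n) : Type := {i : Fin n // i ∉ workSet t x}

/-- The KKT matrix `(H_F, J_Fᵀ; J_F, -μ I)` of the free variables. -/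
def kktMat {n m : ℕ} (f : E n → ℝ) (c : E n → E m) (μ t : ℝ) (x : E n) (y : E m) :
    Matrix (Free t x ⊕ Fin m) (Free t x ⊕ Fin m) ℝ :=
  Matrix.fromBlocks ((lagHess f c x y).submatrix Subtype.val Subtype.val)
    ((jac c x).submatrix id Subtype.val)ᵀ
    ((jac c x).submatrix id Subtype.val)
    (-μ • (1 : Matrix (Fin m) (Fin m) ℝ))

/-- `u` is a computed direction of negative curvature at `(x, y)`: its free part is the primal part
of a vector obtained from the factorization of the KKT matrix, and `uᵢ = 0` for `i ∈ 𝒲`. -/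
def IsCurvDir {n m : ℕ} (f : E n → ℝ) (c : E n → E m) (θ Λ μ t : ℝ) (x : E n) (y : E m)
    (u : E n) : Prop :=
  (∀ i ∈ workSet t x, u i = 0) ∧
    ∃ w : Free t x ⊕ Fin m → ℝ, IsCurvSolve (kktMat f c μ t x y) θ Λ w ∧
      ∀ i : Free t x, u i.1 = w (Sum.inl i)

/-- `uᵀ (H + (1/μ) Jᵀ J) u / ‖u‖²`, read as `0` if `u = 0` (no direction of negative curvature). -/
def curvature {n m : ℕ} (f : E n → ℝ) (c : E n → E m) (μ : ℝ) (x : E n) (y : E m) (u : E n) : ℝ :=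
  (u.ofLp ⬝ᵥ ((lagHess f c x y + (1 / μ) • ((jac c x)ᵀ * jac c x)) *ᵥ u.ofLp)) / ‖u‖ ^ 2

/-- The infeasibility measure `η(x) = ‖c(x)‖`. -/
def eta {n m : ℕ} (c : E n → E m) (x : E n) : ℝ := ‖c x‖

/-- The optimality measure `ω`: the larger of the first-order residual
`‖min(x, g(x) - J(x)ᵀ y)‖` and the computed negative curvature. -/
def omega {n m : ℕ} (f : E n → ℝ) (c : E n → E m) (μ : ℝ) (x : E n) (y : E m) (u : E n) : ℝ :=
  max ‖(WithLp.toLp 2 (fun i => min (x i) (dualRes f c x y i)) : E n)‖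
    (-curvature f c μ x y u)

/-- `φ_S = η + 10⁻⁵ ω`. -/
def phiS {n m : ℕ} (f : E n → ℝ) (c : E n → E m) (μ : ℝ) (x : E n) (y : E m) (u : E n) : ℝ :=
  eta c x + (1 / 10 ^ 5) * omega f c μ x y u

/-- `φ_L = 10⁻⁵ η + ω`. -/
def phiL {n m : ℕ} (f : E n → ℝ) (c : E n → E m) (μ : ℝ) (x : E n) (y : E m) (u : E n) : ℝ :=
  (1 / 10 ^ 5) * eta c x + omega f c μ x y u

/-- A run of the method, as far as it enters the tests for S- and L-iterates. The computation of
`v (k+1)` from `v k` (QP step, step of negative curvature, line search) and the updates of the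
regularization parameter, of the multiplier estimates and of the tolerances for M-iterates are not
restricted at all: every run, with any choice of these, is an instance. -/
structure Run {n m : ℕ} (f : E n → ℝ) (c : E n → E m) where
  /-- primal iterates -/
  x : ℕ → E n
  /-- dual iterates -/
  y : ℕ → E m
  /-- regularization parameter in the KKT matrix at the `k`-th iterate -/
  μ : ℕ → ℝ
  μ_pos : ∀ k, 0 < μ k
  /-- tolerance of the active-set estimate; it must converge to zero -/
  tol : ℕ → ℝ
  tol_pos : ∀ k, 0 < tol k
  tol_tendsto : Tendsto tol atTop (𝓝 0)
  /-- relative threshold for `H⁺` pivots -/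
  θ : ℝ
  θ_nonneg : 0 ≤ θ
  θ_lt_one : θ < 1
  /-- bound on the multipliers that the pivoting strategy allows -/
  Λ : ℝ
  /-- directions of negative curvature -/
  u : ℕ → E n
  u_spec : ∀ k, IsCurvDir f c θ Λ (μ k) (tol k) (x k) (y k) (u k)
  /-- `φ_S^max` in force when the iterate `k+1` is tested -/
  maxS : ℕ → ℝ
  /-- `φ_L^max` in force when the iterate `k+1` is tested -/
  maxL : ℕ → ℝ
  maxS_zero : 0 < maxS 0
  maxL_zero : 0 < maxL 0
  update_S : ∀ k, phiS f c (μ (k+1)) (x (k+1)) (y (k+1)) (u (k+1)) ≤ 1 / 2 * maxS k →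
    maxS (k+1) = 1 / 2 * maxS k ∧ maxL (k+1) = maxL k
  update_L : ∀ k, ¬ phiS f c (μ (k+1)) (x (k+1)) (y (k+1)) (u (k+1)) ≤ 1 / 2 * maxS k →
    phiL f c (μ (k+1)) (x (k+1)) (y (k+1)) (u (k+1)) ≤ 1 / 2 * maxL k →
    maxS (k+1) = maxS k ∧ maxL (k+1) = 1 / 2 * maxL k
  update_other : ∀ k, ¬ phiS f c (μ (k+1)) (x (k+1)) (y (k+1)) (u (k+1)) ≤ 1 / 2 * maxS k →
    ¬ phiL f c (μ (k+1)) (x (k+1)) (y (k+1)) (u (k+1)) ≤ 1 / 2 * maxL k →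
    maxS (k+1) = maxS k ∧ maxL (k+1) = maxL k

/-- The iterate `k` is an S-iterate (the starting point is not tested). -/
def Run.IsS {n m : ℕ} {f : E n → ℝ} {c : E n → E m} (r : Run f c) : ℕ → Prop
  | 0 => False
  | k + 1 => phiS f c (r.μ (k+1)) (r.x (k+1)) (r.y (k+1)) (r.u (k+1)) ≤ 1 / 2 * r.maxS k

/-- The iterate `k` is an L-iterate. -/
def Run.IsL {n m : ℕ} {f : E n → ℝ} {c : E n → E m} (r : Run f c) : ℕ → Prop
  | 0 => False
  | k + 1 => ¬ r.IsS (k+1) ∧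
      phiL f c (r.μ (k+1)) (r.x (k+1)) (r.y (k+1)) (r.u (k+1)) ≤ 1 / 2 * r.maxL k

end PdSQP

end

open Filter Topology Matrix

noncomputable section

namespace PdSQP

/-! ### Linear algebra of a single pivot -/

section Pivot

variable {ι : Type*}

/-! At each iterate, let `ρ` be the largest entry of the final Schur complement `S`. It controls the
curvature in two ways (`IsCurvSolve.exists_rho`).

Lower bound: an `H⁺` pivot decreases the quadratic form, and a pivot that removes a `D`-row
decreases it at least on a hyperplane. So the form of `S` lies below that of `K` on a subspace of
dimension at least the number of `H`-rows (`StageOne.exists_submodule`). Because of the block `-μ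
I`, this subspace projects bijectively onto the `H`-components, and hence `aᵀ H a ≥ -ρ ‖a‖₁²`
whenever `J a = 0`.

Upper bound: back substitution gives `K w = S w` (`StageOne.mulVec_eq`), so the computed direction
has curvature form at most `-(1 - θ) ρ²`, while bounded multipliers keep its size of order `√ρ`
(`StageOne.abs_le`).

If `ρ > 0`, the Rayleigh quotient along the direction is thus at most a negative multiple of `ρ`, so
in all cases `ρ ≤ C ω`, with `C` independent of `μ` and of the iterate
(`IsCurvDir.neg_le_dotProduct`). Repeated halving makes `ω` arbitrarily small along the subsequence
(`Run.frequently_omega_le`). Constant rank makes every critical direction a limit of null vectors at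
the iterates (`exists_tendsto_mulVec_eq_zero`). These vanish on the estimated active set, which is
eventually contained in the true one, and the lower bounds pass to the limit. -/

theorem elim1_isSymm {A : Matrix ι ι ℝ} (hA : A.IsSymm) (p : ι) : (elim1 A p).IsSymm := by
  ext r s
  simp only [elim1, transpose_apply]
  rw [hA.apply r s, hA.apply p s, hA.apply r p]
  ring

theorem elim2_isSymm {A : Matrix ι ι ℝ} (hA : A.IsSymm) (i j : ι) : (elim2 A i j).IsSymm := by
  ext r s
  simp only [elim2, mult2, pivDet, transpose_apply]
  rw [hA.apply r s, hA.apply i s, hA.apply j s, hA.apply r i, hA.apply r j, hA.apply i j,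
    mul_comm (A j j) (A i i)]
  ring

theorem mult2_self {A : Matrix ι ι ℝ} {i j : ι} (h : pivDet A i j ≠ 0) : mult2 A i j i = 1 :=
  div_self h

theorem mult2_other (A : Matrix ι ι ℝ) (i j : ι) : mult2 A i j j = 0 := by
  simp [mult2, mul_comm]

theorem pivDet_comm (A : Matrix ι ι ℝ) (i j : ι) : pivDet A j i = pivDet A i j := by
  simp only [pivDet]; ring

theorem elim1_pivot {A : Matrix ι ι ℝ} {p : ι} (h : A p p ≠ 0) (s : ι) : elim1 A p p s = 0 := by
  simp only [elim1]; field_simp; ring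

theorem elim2_fst {A : Matrix ι ι ℝ} {i j : ι} (h : pivDet A i j ≠ 0) (s : ι) :
    elim2 A i j i s = 0 := by
  simp [elim2, mult2_self h, mult2_other]

theorem elim2_snd {A : Matrix ι ι ℝ} {i j : ι} (h : pivDet A i j ≠ 0) (s : ι) :
    elim2 A i j j s = 0 := by
  rw [← pivDet_comm] at h
  simp [elim2, mult2_self h, mult2_other]

theorem elim1_row_eq_zero {A : Matrix ι ι ℝ} {a : ι} (h : ∀ b, A a b = 0) (p s : ι) :
    elim1 A p a s = 0 := by
  simp [elim1, h]

theorem mult2_eq_zero {A : Matrix ι ι ℝ} {a : ι} (h : ∀ b, A a b = 0) (i j : ι) :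
    mult2 A i j a = 0 := by
  simp [mult2, h]

theorem elim2_row_eq_zero {A : Matrix ι ι ℝ} {a : ι} (h : ∀ b, A a b = 0) (i j s : ι) :
    elim2 A i j a s = 0 := by
  simp [elim2, mult2_eq_zero h, h]

/-! ### Products and quadratic forms under a pivot. -/

variable [Fintype ι]

theorem sum_row_mul_eq_mulVec (A : Matrix ι ι ℝ) (v : ι → ℝ) (p : ι) :
    ∑ s, A p s * v s = (A *ᵥ v) p := rfl

theorem elim1_mulVec (A : Matrix ι ι ℝ) (p : ι) (v : ι → ℝ) (r : ι) :
    (elim1 A p *ᵥ v) r = (A *ᵥ v) r - A r p / A p p * (A *ᵥ v) p := by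
  simp only [← sum_row_mul_eq_mulVec, elim1, Finset.mul_sum, ← Finset.sum_sub_distrib]
  exact Finset.sum_congr rfl fun s _ => by ring

theorem elim2_mulVec (A : Matrix ι ι ℝ) (i j : ι) (v : ι → ℝ) (r : ι) :
    (elim2 A i j *ᵥ v) r =
      (A *ᵥ v) r - (mult2 A i j r * (A *ᵥ v) i + mult2 A j i r * (A *ᵥ v) j) := by
  simp only [← sum_row_mul_eq_mulVec, elim2, Finset.mul_sum, ← Finset.sum_add_distrib,
    ← Finset.sum_sub_distrib]
  exact Finset.sum_congr rfl fun s _ => by ring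

theorem sum_col_mul_eq_mulVec {A : Matrix ι ι ℝ} (hA : A.IsSymm) (v : ι → ℝ) (p : ι) :
    ∑ s, A s p * v s = (A *ᵥ v) p := by
  rw [← sum_row_mul_eq_mulVec]
  exact Finset.sum_congr rfl fun s _ => by rw [hA.apply p s]

theorem sum_div_mul_eq {A : Matrix ι ι ℝ} (hA : A.IsSymm) (v : ι → ℝ) (p : ι) (t : ℝ) :
    ∑ s, A s p / t * v s = (A *ᵥ v) p / t := by
  rw [← sum_col_mul_eq_mulVec hA, Finset.sum_div]
  exact Finset.sum_congr rfl fun s _ => by ring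

theorem sum_mult2_mul_eq {A : Matrix ι ι ℝ} (hA : A.IsSymm) (v : ι → ℝ) (i j : ι) :
    ∑ s, mult2 A i j s * v s =
      ((A *ᵥ v) i * A j j - (A *ᵥ v) j * A j i) / pivDet A i j := by
  rw [← sum_col_mul_eq_mulVec hA v i, ← sum_col_mul_eq_mulVec hA v j, Finset.sum_mul,
    Finset.sum_mul, ← Finset.sum_sub_distrib, Finset.sum_div]
  exact Finset.sum_congr rfl fun s _ => by simp only [mult2]; ring

/-- The quadratic form of `A` loses `(A v)_p² / A_pp` in a `1 × 1` pivot. -/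
theorem dotProduct_elim1 {A : Matrix ι ι ℝ} (hA : A.IsSymm) (p : ι) (v : ι → ℝ) :
    v ⬝ᵥ (elim1 A p *ᵥ v) = v ⬝ᵥ (A *ᵥ v) - (A *ᵥ v) p ^ 2 / A p p := by
  have h : ∑ r, v r * (A r p / A p p * (A *ᵥ v) p) = (A *ᵥ v) p ^ 2 / A p p := by
    rw [sq, mul_div_right_comm, ← sum_div_mul_eq hA v p, Finset.sum_mul]
    exact Finset.sum_congr rfl fun s _ => by ring
  simp only [dotProduct, elim1_mulVec, mul_sub, Finset.sum_sub_distrib, h]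

/-- The change of the quadratic form of `A` in a `2 × 2` pivot. -/
theorem dotProduct_elim2 {A : Matrix ι ι ℝ} (hA : A.IsSymm) (i j : ι) (v : ι → ℝ) :
    v ⬝ᵥ (elim2 A i j *ᵥ v) = v ⬝ᵥ (A *ᵥ v) -
      (A j j * (A *ᵥ v) i ^ 2 - 2 * A i j * (A *ᵥ v) i * (A *ᵥ v) j + A i i * (A *ᵥ v) j ^ 2) /
        pivDet A i j := by
  have h : ∑ r, v r * (mult2 A i j r * (A *ᵥ v) i + mult2 A j i r * (A *ᵥ v) j) =
      (∑ r, mult2 A i j r * v r) * (A *ᵥ v) i + (∑ r, mult2 A j i r * v r) * (A *ᵥ v) j := by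
    rw [Finset.sum_mul, Finset.sum_mul, ← Finset.sum_add_distrib]
    exact Finset.sum_congr rfl fun s _ => by ring
  simp only [dotProduct, elim2_mulVec, mul_sub, Finset.sum_sub_distrib, h]
  rw [sum_mult2_mul_eq hA, sum_mult2_mul_eq hA, pivDet_comm A i j, hA.apply i j]
  ring

/-- By symmetry the pivot column of `L` pairs with `v` to `(A v)_p / A_pp`, and `(A v)_p` is the
factor in all that the pivot subtracts from `A v`. -/
theorem elim1_mulVec_eq {A : Matrix ι ι ℝ} (hA : A.IsSymm) {p : ι} (hp : A p p ≠ 0) {v : ι → ℝ}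
    (hv : ∑ s, A s p / A p p * v s = 0) : elim1 A p *ᵥ v = A *ᵥ v := by
  rw [sum_div_mul_eq hA, div_eq_zero_iff, or_iff_left hp] at hv
  ext r
  simp [elim1_mulVec, hv]

/-- The two pairings form the inverse pivot block applied to `((A v)_i, (A v)_j)`; multiplying back
by the block shows that both entries vanish. -/
theorem elim2_mulVec_eq {A : Matrix ι ι ℝ} (hA : A.IsSymm) {i j : ι} (hd : pivDet A i j ≠ 0)
    {v : ι → ℝ} (hi : ∑ s, mult2 A i j s * v s = 0) (hj : ∑ s, mult2 A j i s * v s = 0) :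
    elim2 A i j *ᵥ v = A *ᵥ v := by
  rw [sum_mult2_mul_eq hA, div_eq_zero_iff] at hi hj
  rw [pivDet_comm] at hj
  rw [or_iff_left hd] at hi hj
  have h1 : (A *ᵥ v) i = 0 := by
    refine (mul_eq_zero.1 (?_ : pivDet A i j * (A *ᵥ v) i = 0)).resolve_left hd
    simp only [pivDet]
    linear_combination A i i * hi + A j i * hj
  have h2 : (A *ᵥ v) j = 0 := by
    refine (mul_eq_zero.1 (?_ : pivDet A i j * (A *ᵥ v) j = 0)).resolve_left hd
    simp only [pivDet]
    linear_combination A i j * hi + A j j * hj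
  ext r
  simp [elim2_mulVec, h1, h2]

/-- An indefinite `2 × 2` pivot reduces the quadratic form on some hyperplane. -/
theorem exists_functional_elim2_le {A : Matrix ι ι ℝ} (hA : A.IsSymm) {i j : ι}
    (hd : pivDet A i j < 0) :
    ∃ φ : (ι → ℝ) →ₗ[ℝ] ℝ, ∀ v, φ v = 0 → v ⬝ᵥ (elim2 A i j *ᵥ v) ≤ v ⬝ᵥ (A *ᵥ v) := by
  -- With `a = (A v)_i` and `b = (A v)_j`, the pivot subtracts the adjugate form in `(a, b)` divided
  -- by the negative determinant. It suffices to find a line on which the adjugate form is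
  -- nonpositive.
  suffices h : ∃ s t : ℝ, ∀ a b : ℝ, s * a + t * b = 0 →
      A j j * a ^ 2 - 2 * A i j * a * b + A i i * b ^ 2 ≤ 0 by
    obtain ⟨s, t, h⟩ := h
    refine ⟨s • (LinearMap.proj i ∘ₗ A.mulVecLin) + t • (LinearMap.proj j ∘ₗ A.mulVecLin),
      fun v hv => ?_⟩
    rw [dotProduct_elim2 hA]
    have := div_nonneg_of_nonpos (h ((A *ᵥ v) i) ((A *ᵥ v) j) (by simpa using hv)) hd.le
    linarith
  rw [pivDet, hA.apply i j] at hd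
  rcases le_or_gt (A j j) 0 with hj | hj
  · refine ⟨0, 1, fun a b hab => ?_⟩
    obtain rfl : b = 0 := by simpa using hab
    nlinarith [sq_nonneg a]
  · refine ⟨A j j, -A i j, fun a b hab => ?_⟩
    -- Complete the square: `A_jj` times the form is `(A_jj a - A_ij b)² + det · b²`, and the line
    -- is chosen to kill the square.
    have e : A j j * (A j j * a ^ 2 - 2 * A i j * a * b + A i i * b ^ 2) =
        (A i i * A j j - A i j * A i j) * b ^ 2 := by
      linear_combination (A j j * a - A i j * b) * hab
    have := mul_nonpos_of_nonpos_of_nonneg hd.le (sq_nonneg b)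
    rw [← e] at this
    exact nonpos_of_mul_nonpos_right this hj

theorem finrank_le_inf_ker_add_one (W : Submodule ℝ (ι → ℝ)) (φ : (ι → ℝ) →ₗ[ℝ] ℝ) :
    Module.finrank ℝ W ≤ Module.finrank ℝ (W ⊓ LinearMap.ker φ : Submodule ℝ (ι → ℝ)) + 1 := by
  have h1 := Submodule.finrank_sup_add_finrank_inf_eq W (LinearMap.ker φ)
  have h2 := Submodule.finrank_le (W ⊔ LinearMap.ker φ)
  have h3 := φ.finrank_range_add_finrank_ker
  have h4 : Module.finrank ℝ (LinearMap.range φ) ≤ 1 := by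
    simpa using Submodule.finrank_le (LinearMap.range φ)
  omega

/-- One step of back substitution: replacing identity columns of `L` by the columns of a pivot
block with entries bounded by `Λ` increases `Lᵀ v` at most by the factor `1 + N Λ`. -/
theorem abs_transpose_mulVec_le_of_step [DecidableEq ι] {L L' : Matrix ι ι ℝ} {R T : Finset ι}
    {Λ M : ℝ} {v : ι → ℝ} (hΛ0 : 0 ≤ Λ) (hM0 : 0 ≤ M)
    (hL : ∀ r ∈ R, ∀ a, L a r = (1 : Matrix ι ι ℝ) a r) (hTR : T ⊆ R)
    (hL' : ∀ a, ∀ b ∉ T, L' a b = L a b)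
    (hT : ∀ a ∈ T, ∀ b ∈ T, L' a b = (1 : Matrix ι ι ℝ) a b)
    (hR : ∀ a ∉ R, ∀ b ∈ T, L' a b = 0) (hΛ : ∀ a b, |L' a b| ≤ Λ)
    (hM : ∀ p, |(L'ᵀ *ᵥ v) p| ≤ M) (p : ι) :
    |(Lᵀ *ᵥ v) p| ≤ (1 + Fintype.card ι * Λ) * M := by
  have hN : 0 ≤ Fintype.card ι * Λ * M := by positivity
  have hcol : ∀ r ∈ R, (Lᵀ *ᵥ v) r = v r := fun r hr => by
    simp [mulVec, dotProduct, hL r hr, one_apply]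
  have hsame : ∀ b ∉ T, (Lᵀ *ᵥ v) b = (L'ᵀ *ᵥ v) b := fun b hb => by
    simp only [mulVec, dotProduct, transpose_apply, hL' _ b hb]
  by_cases hp : p ∈ T
  -- Column `p` of the old `L` is an identity column, so `v p` itself has to be bounded. Solving for
  -- it involves only `v a` with `a ∈ R \ T`, and these are already components of `L'ᵀ v`.
  · have e : v p = (L'ᵀ *ᵥ v) p - ∑ a, (if a ∈ T then 0 else L' a p * v a) := by
      have : ∀ a, L' a p * v a =
          (if a = p then v a else 0) + (if a ∈ T then 0 else L' a p * v a) := fun a => by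
        by_cases ha : a ∈ T
        · rw [hT a ha p hp, one_apply, if_pos ha]
          split_ifs <;> simp
        · have : a ≠ p := fun h => ha (h ▸ hp)
          simp [ha, this]
      simp only [mulVec, dotProduct, transpose_apply]
      rw [Finset.sum_congr rfl fun a _ => this a, Finset.sum_add_distrib]
      simp
    have hs : |∑ a, (if a ∈ T then 0 else L' a p * v a)| ≤ Fintype.card ι * (Λ * M) := by
      refine (Finset.abs_sum_le_sum_abs _ _).trans ?_
      refine (Finset.sum_le_card_nsmul _ _ (Λ * M) fun a _ => ?_).trans_eq (by simp)
      split_ifs with ha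
      · simpa using mul_nonneg hΛ0 hM0
      · by_cases haR : a ∈ R
        · rw [abs_mul, ← hcol a haR, hsame a ha]
          exact mul_le_mul (hΛ _ _) (hM _) (abs_nonneg _) hΛ0
        · simpa [hR a haR p hp] using mul_nonneg hΛ0 hM0
    rw [hcol p (hTR hp), e]
    refine (abs_sub _ _).trans ?_
    linarith [hM p]
  · rw [hsame p hp]
    linarith [hM p]

theorem card_remaining_erase {α β : Type*} [Fintype β] [DecidableEq α] [DecidableEq β]
    (R : Finset (α ⊕ β)) {j : β} (hj : Sum.inr j ∈ R) :
    (Finset.univ.filter fun k : β => Sum.inr k ∈ R.erase (Sum.inr j)).card + 1 =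
      (Finset.univ.filter fun k : β => Sum.inr k ∈ R).card := by
  have e : (Finset.univ.filter fun k : β => Sum.inr k ∈ R.erase (Sum.inr j)) =
      (Finset.univ.filter fun k : β => Sum.inr k ∈ R).erase j := by
    ext k; simp
  rw [e, Finset.card_erase_add_one (by simpa using hj)]

end Pivot

/-! ### Invariants of the factorization -/

section Factorization

variable {α β : Type*} [Fintype α] [Fintype β] [DecidableEq α] [DecidableEq β]
variable {K L A : Matrix (α ⊕ β) (α ⊕ β) ℝ} {R : Finset (α ⊕ β)}

theorem StageOne.isSymm (h : StageOne K R L A) (hK : K.IsSymm) : A.IsSymm := by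
  induction h with
  | start => exact hK
  | hplus R L A i _ _ _ ih => exact elim1_isSymm ih _
  | dminus R L A j _ _ _ ih => exact elim1_isSymm ih _
  | hd R L A i j _ _ _ _ ih => exact elim2_isSymm ih _ _

/-- A pivot annihilates its own rows, and zero rows stay zero under later pivots. -/
theorem StageOne.row_eq_zero (h : StageOne K R L A) :
    ∀ a ∉ R, ∀ b, A a b = 0 := by
  induction h with
  | start => simp
  | hplus R L A i _ _ hp ih =>
    intro a ha b
    rcases eq_or_ne a (Sum.inl i) with rfl | hne
    · exact elim1_pivot hp.ne' b
    · exact elim1_row_eq_zero (ih a fun h => ha (Finset.mem_erase.2 ⟨hne, h⟩)) _ _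
  | dminus R L A j _ _ hp ih =>
    intro a ha b
    rcases eq_or_ne a (Sum.inr j) with rfl | hne
    · exact elim1_pivot hp.ne b
    · exact elim1_row_eq_zero (ih a fun h => ha (Finset.mem_erase.2 ⟨hne, h⟩)) _ _
  | hd R L A i j _ _ _ hp ih =>
    intro a ha b
    rcases eq_or_ne a (Sum.inl i) with rfl | hi
    · exact elim2_fst hp.ne b
    rcases eq_or_ne a (Sum.inr j) with rfl | hj
    · exact elim2_snd hp.ne b
    · exact elim2_row_eq_zero
        (ih a fun h => ha (Finset.mem_erase.2 ⟨hj, Finset.mem_erase.2 ⟨hi, h⟩⟩)) _ _ _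

theorem StageOne.col_eq_one (h : StageOne K R L A) :
    ∀ r ∈ R, ∀ a, L a r = (1 : Matrix (α ⊕ β) (α ⊕ β) ℝ) a r := by
  induction h with
  | start => simp
  | hplus R L A i _ _ _ ih =>
    intro r hr a
    rw [Finset.mem_erase] at hr
    rw [updateCol_ne hr.1, ih r hr.2]
  | dminus R L A j _ _ _ ih =>
    intro r hr a
    rw [Finset.mem_erase] at hr
    rw [updateCol_ne hr.1, ih r hr.2]
  | hd R L A i j _ _ _ _ ih =>
    intro r hr a
    rw [Finset.mem_erase, Finset.mem_erase] at hr
    rw [updateCol_ne hr.1, updateCol_ne hr.2.1, ih r hr.2.2]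

theorem StageOne.transpose_mulVec_apply (h : StageOne K R L A) (v : α ⊕ β → ℝ) {r : α ⊕ β}
    (hr : r ∈ R) : (Lᵀ *ᵥ v) r = v r := by
  simp [mulVec, dotProduct, h.col_eq_one r hr, one_apply]

/-- Solving `Lᵀ v = z` with `z` supported on the remaining indices reduces `K v` to the
product with the Schur complement. -/
theorem StageOne.mulVec_eq (h : StageOne K R L A) (hK : K.IsSymm) (v : α ⊕ β → ℝ) :
    (∀ p ∉ R, (Lᵀ *ᵥ v) p = 0) → K *ᵥ v = A *ᵥ v := by
  have one_step : ∀ {R : Finset (α ⊕ β)} {L A : Matrix (α ⊕ β) (α ⊕ β) ℝ} {p : α ⊕ β},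
      StageOne K R L A → A p p ≠ 0 → p ∈ R →
      ((∀ q ∉ R, (Lᵀ *ᵥ v) q = 0) → K *ᵥ v = A *ᵥ v) →
      (∀ q ∉ R.erase p, ((L.updateCol p fun r => A r p / A p p)ᵀ *ᵥ v) q = 0) →
      K *ᵥ v = elim1 A p *ᵥ v := by
    intro R L A p hs hp hpR ih hv
    -- The equation at the pivot says `(A v)_p = 0`, so this pivot leaves `A v` unchanged; the other
    -- equations outside `R` are those of the previous factor.
    have hvp := hv p (by simp)
    simp only [mulVec, dotProduct, transpose_apply, updateCol_self] at hvp
    rw [elim1_mulVec_eq (hs.isSymm hK) hp hvp]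
    refine ih fun q hq => ?_
    have hqp : q ≠ p := fun h => hq (h ▸ hpR)
    have := hv q fun h => hq (Finset.mem_of_mem_erase h)
    simpa only [mulVec, dotProduct, transpose_apply, updateCol_ne hqp] using this
  induction h with
  | start => intro _; rfl
  | hplus R L A i hs hi hp ih => exact one_step hs hp.ne' hi ih
  | dminus R L A j hs hj hp ih => exact one_step hs hp.ne hj ih
  | hd R L A i j hs hi hj hp ih =>
    intro hv
    have hvi := hv (Sum.inl i) (by simp)
    have hvj := hv (Sum.inr j) (by simp)
    have hij : (Sum.inl i : α ⊕ β) ≠ Sum.inr j := by simp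
    simp only [mulVec, dotProduct, transpose_apply, updateCol_self] at hvj
    simp only [mulVec, dotProduct, transpose_apply, updateCol_ne hij, updateCol_self] at hvi
    rw [elim2_mulVec_eq (hs.isSymm hK) hp.ne hvi hvj]
    refine ih fun q hq => ?_
    have hqi : q ≠ Sum.inl i := fun h => hq (h ▸ hi)
    have hqj : q ≠ Sum.inr j := fun h => hq (h ▸ hj)
    have := hv q fun h => hq (Finset.mem_of_mem_erase (Finset.mem_of_mem_erase h))
    simpa only [mulVec, dotProduct, transpose_apply, updateCol_ne hqi, updateCol_ne hqj] using this

/-- Back substitution with a factor whose entries are bounded by `Λ`. -/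
theorem StageOne.abs_le (h : StageOne K R L A) {Λ : ℝ} (hΛ1 : 1 ≤ Λ) (v : α ⊕ β → ℝ) :
    (∀ a b, |L a b| ≤ Λ) → ∀ M, 0 ≤ M → (∀ p, |(Lᵀ *ᵥ v) p| ≤ M) → ∀ p,
      |v p| ≤ (1 + Fintype.card (α ⊕ β) * Λ) ^ (Fintype.card (α ⊕ β) - R.card) * M := by
  have hΛ0 : 0 ≤ Λ := zero_le_one.trans hΛ1
  have hD : 1 ≤ 1 + Fintype.card (α ⊕ β) * Λ := le_add_of_nonneg_right (by positivity)
  -- `T` is the pivot block, of size one or two. Each pivot costs one factor of the base, and the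
  -- exponent grows by `T.card ≥ 1`.
  have step : ∀ {R T : Finset (α ⊕ β)} {L L' A : Matrix (α ⊕ β) (α ⊕ β) ℝ},
      StageOne K R L A → T.Nonempty → T ⊆ R →
      ((∀ a b, |L a b| ≤ Λ) → ∀ M, 0 ≤ M → (∀ p, |(Lᵀ *ᵥ v) p| ≤ M) → ∀ p,
        |v p| ≤ (1 + Fintype.card (α ⊕ β) * Λ) ^ (Fintype.card (α ⊕ β) - R.card) * M) →
      (∀ a, ∀ b ∉ T, L' a b = L a b) →
      (∀ a ∈ T, ∀ b ∈ T, L' a b = (1 : Matrix (α ⊕ β) (α ⊕ β) ℝ) a b) →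
      (∀ a ∉ R, ∀ b ∈ T, L' a b = 0) →
      (∀ a b, |L' a b| ≤ Λ) → ∀ M, 0 ≤ M → (∀ p, |(L'ᵀ *ᵥ v) p| ≤ M) → ∀ p,
        |v p| ≤ (1 + Fintype.card (α ⊕ β) * Λ) ^ (Fintype.card (α ⊕ β) - (R \ T).card) * M := by
    intro R T L L' A hs hT0 hTR ih h1 h2 h3 hΛ M hM0 hM p
    -- The old factor has identity columns at `T`; this is where `1 ≤ Λ` enters.
    have hL : ∀ a b, |L a b| ≤ Λ := fun a b => by
      by_cases hb : b ∈ T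
      · rw [hs.col_eq_one b (hTR hb), one_apply]
        split_ifs <;> simp [hΛ1, hΛ0]
      · rw [← h1 a b hb]; exact hΛ a b
    refine (ih hL _ (by positivity) (abs_transpose_mulVec_le_of_step hΛ0 hM0 hs.col_eq_one
      hTR h1 h2 h3 hΛ hM) p).trans ?_
    rw [← mul_assoc, ← pow_succ]
    refine mul_le_mul_of_nonneg_right (pow_le_pow_right₀ hD ?_) hM0
    have := Finset.card_sdiff_add_card_eq_card hTR
    have := hT0.card_pos
    have := Finset.card_le_univ R
    omega
  have step1 : ∀ {R : Finset (α ⊕ β)} {L A : Matrix (α ⊕ β) (α ⊕ β) ℝ} {p : α ⊕ β},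
      StageOne K R L A → A p p ≠ 0 → p ∈ R →
      ((∀ a b, |L a b| ≤ Λ) → ∀ M, 0 ≤ M → (∀ p, |(Lᵀ *ᵥ v) p| ≤ M) → ∀ p,
        |v p| ≤ (1 + Fintype.card (α ⊕ β) * Λ) ^ (Fintype.card (α ⊕ β) - R.card) * M) →
      (∀ a b, |(L.updateCol p fun r => A r p / A p p) a b| ≤ Λ) → ∀ M, 0 ≤ M →
      (∀ q, |((L.updateCol p fun r => A r p / A p p)ᵀ *ᵥ v) q| ≤ M) → ∀ q,
        |v q| ≤ (1 + Fintype.card (α ⊕ β) * Λ) ^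
          (Fintype.card (α ⊕ β) - (R.erase p).card) * M := by
    intro R L A p hs hp hpR ih
    rw [Finset.erase_eq]
    refine step hs (Finset.singleton_nonempty p) (by simpa using hpR) ih ?_ ?_ ?_
    · intro a b hb
      exact updateCol_ne (by simpa using hb)
    · intro a ha b hb
      obtain rfl := Finset.mem_singleton.1 ha
      obtain rfl := Finset.mem_singleton.1 hb
      rw [updateCol_self, div_self hp, one_apply_eq]
    · intro a ha b hb
      obtain rfl := Finset.mem_singleton.1 hb
      rw [updateCol_self, hs.row_eq_zero a ha, zero_div]
  induction h with
  | start => intro _ M hM0 hM p; simpa using hM p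
  | hplus R L A i hs hi hp ih => exact step1 hs hp.ne' hi ih
  | dminus R L A j hs hj hp ih => exact step1 hs hp.ne hj ih
  | hd R L A i j hs hi hj hp ih =>
    have hij : (Sum.inl i : α ⊕ β) ≠ Sum.inr j := by simp
    have e : (R.erase (Sum.inl i)).erase (Sum.inr j) = R \ {Sum.inl i, Sum.inr j} := by
      ext a; simp; tauto
    rw [e]
    refine step hs (by simp) (by simp [Finset.insert_subset_iff, hi, hj]) ih ?_ ?_ ?_
    · intro a b hb
      simp only [Finset.mem_insert, Finset.mem_singleton, not_or] at hb
      rw [updateCol_ne hb.2, updateCol_ne hb.1]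
    · intro a ha b hb
      have hp' : pivDet A (Sum.inr j) (Sum.inl i) ≠ 0 := by rw [pivDet_comm]; exact hp.ne
      simp only [Finset.mem_insert, Finset.mem_singleton] at ha hb
      rcases hb with rfl | rfl
      · rw [updateCol_ne hij, updateCol_self]
        rcases ha with rfl | rfl
        · rw [mult2_self hp.ne, one_apply_eq]
        · rw [mult2_other, one_apply_ne hij.symm]
      · rw [updateCol_self]
        rcases ha with rfl | rfl
        · rw [mult2_other, one_apply_ne hij]
        · rw [mult2_self hp', one_apply_eq]
    · intro a ha b hb
      simp only [Finset.mem_insert, Finset.mem_singleton] at hb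
      rcases hb with rfl | rfl
      · rw [updateCol_ne hij, updateCol_self, mult2_eq_zero (hs.row_eq_zero a ha)]
      · rw [updateCol_self, mult2_eq_zero (hs.row_eq_zero a ha)]

/-- Inertia control: each elimination of a `D`-row costs one negative eigenvalue, so that the
quadratic form of the Schur complement is a lower bound on a large subspace. -/
theorem StageOne.exists_submodule (h : StageOne K R L A) (hK : K.IsSymm) :
    ∃ W : Submodule ℝ (α ⊕ β → ℝ),
      Fintype.card α + (Finset.univ.filter fun j : β => Sum.inr j ∈ R).card ≤
        Module.finrank ℝ W ∧
      ∀ v ∈ W, v ⬝ᵥ (A *ᵥ v) ≤ v ⬝ᵥ (K *ᵥ v) := by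
  -- Intersecting `W` with the hyperplane loses at most one dimension, matched by the one `D`-row
  -- that leaves `R`.
  have cut : ∀ {R : Finset (α ⊕ β)} {A A' : Matrix (α ⊕ β) (α ⊕ β) ℝ} {j : β},
      Sum.inr j ∈ R →
      (∃ φ : (α ⊕ β → ℝ) →ₗ[ℝ] ℝ, ∀ v, φ v = 0 → v ⬝ᵥ (A' *ᵥ v) ≤ v ⬝ᵥ (A *ᵥ v)) →
      (∃ W : Submodule ℝ (α ⊕ β → ℝ),
        Fintype.card α + (Finset.univ.filter fun j : β => Sum.inr j ∈ R).card ≤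
          Module.finrank ℝ W ∧ ∀ v ∈ W, v ⬝ᵥ (A *ᵥ v) ≤ v ⬝ᵥ (K *ᵥ v)) →
      ∃ W : Submodule ℝ (α ⊕ β → ℝ),
        Fintype.card α +
            (Finset.univ.filter fun k : β => Sum.inr k ∈ R.erase (Sum.inr j)).card ≤
          Module.finrank ℝ W ∧ ∀ v ∈ W, v ⬝ᵥ (A' *ᵥ v) ≤ v ⬝ᵥ (K *ᵥ v) := by
    rintro R A A' j hj ⟨φ, hφ⟩ ⟨W, hW, hWA⟩
    refine ⟨W ⊓ LinearMap.ker φ, ?_, fun v hv => (hφ v hv.2).trans (hWA v hv.1)⟩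
    have := finrank_le_inf_ker_add_one W φ
    have := card_remaining_erase R hj
    omega
  induction h with
  | start => exact ⟨⊤, by simp, fun v _ => le_rfl⟩
  | hplus R L A i hs _ hp ih =>
    obtain ⟨W, hW, hWA⟩ := ih
    refine ⟨W, by simpa using hW, fun v hv => le_trans ?_ (hWA v hv)⟩
    rw [dotProduct_elim1 (hs.isSymm hK)]
    have := div_nonneg (sq_nonneg ((A *ᵥ v) (Sum.inl i))) hp.le
    linarith
  | dminus R L A j hs hj hp ih =>
    refine cut hj ⟨LinearMap.proj (Sum.inr j) ∘ₗ A.mulVecLin, fun v hv => ?_⟩ ih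
    rw [dotProduct_elim1 (hs.isSymm hK)]
    simp only [LinearMap.comp_apply, mulVecLin_apply, LinearMap.proj_apply] at hv
    simp [hv]
  | hd R L A i j hs hi hj hp ih =>
    rw [Finset.erase_right_comm]
    obtain ⟨W, hW, hWA⟩ := cut hj (exists_functional_elim2_le (hs.isSymm hK) hp) ih
    exact ⟨W, by simpa using hW, hWA⟩

end Factorization

/-! ### The computed direction of negative curvature -/

theorem neg_mul_sq_sum_abs_le {ι : Type*} [Fintype ι] {S : Matrix ι ι ℝ} {ρ : ℝ}
    (h : ∀ a b, |S a b| ≤ ρ) (v : ι → ℝ) :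
    -(ρ * (∑ i, |v i|) ^ 2) ≤ v ⬝ᵥ (S *ᵥ v) := by
  refine neg_le_of_abs_le ?_
  rw [sq, Finset.sum_mul_sum]
  simp only [mulVec, dotProduct, Finset.mul_sum]
  refine (Finset.abs_sum_le_sum_abs _ _).trans (Finset.sum_le_sum fun i _ => ?_)
  refine (Finset.abs_sum_le_sum_abs _ _).trans (Finset.sum_le_sum fun j _ => ?_)
  rw [abs_mul, abs_mul]
  nlinarith [mul_le_mul_of_nonneg_right (h i j) (mul_nonneg (abs_nonneg (v i)) (abs_nonneg (v j)))]

/-! ### Curvature of the Schur complement along `h`. -/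

section CurvVec

variable {ι : Type*} [DecidableEq ι]

theorem curvVec_eq_zero (S : Matrix ι ι ℝ) {q r p : ι} (hq : p ≠ q) (hr : p ≠ r) :
    curvVec S q r p = 0 := by
  unfold curvVec
  split_ifs <;> simp [hq, hr]

theorem abs_sign_le_one (x : ℝ) : |Real.sign x| ≤ 1 := by
  rcases Real.sign_apply_eq x with h | h | h <;> simp [h]

theorem abs_curvVec_le_one (S : Matrix ι ι ℝ) (q r p : ι) : |curvVec S q r p| ≤ 1 := by
  have h2 : |1 / √2| ≤ 1 := by
    rw [abs_of_nonneg (by positivity), div_le_one (by positivity)]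
    exact Real.one_le_sqrt.2 one_le_two
  unfold curvVec
  split_ifs with h
  · by_cases hp : p = q <;> simp [hp]
  · by_cases hp : p = q
    · subst hp
      simpa [h] using h2
    · by_cases hp' : p = r
      · subst hp'
        simp only [Pi.smul_apply, Pi.sub_apply, Pi.single_apply, hp, if_false, if_true, zero_sub,
          smul_eq_mul, mul_one, abs_mul, abs_neg]
        exact mul_le_one₀ h2 (abs_nonneg _) (abs_sign_le_one _)
      · simp [hp, hp']

/-- For `q ≠ r` the sign turns the cross term into `-|S_qr|`, and the halved diagonal entries add at
most `θ |S_qr|`. For `q = r` a nonnegative `S_qq ≤ θ S_qq` must be zero, so `S_qq = -|S_qq|`. -/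
theorem curvVec_dotProduct_le [Fintype ι] {S : Matrix ι ι ℝ} (hS : S.IsSymm) {θ : ℝ}
    (hθ0 : 0 ≤ θ) (hθ1 : θ < 1) {q r : ι} (hq : S q q ≤ θ * |S q r|) (hr : S r r ≤ θ * |S q r|) :
    curvVec S q r ⬝ᵥ (S *ᵥ curvVec S q r) ≤ -((1 - θ) * |S q r|) := by
  unfold curvVec
  split_ifs with h
  · subst h
    simp only [mulVec_single_one, single_one_dotProduct, col_apply]
    rcases le_total 0 (S q q) with h0 | h0
    · rw [abs_of_nonneg h0] at hq ⊢
      have : S q q = 0 := le_antisymm (by nlinarith) h0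
      simp [this]
    · rw [abs_of_nonpos h0] at hq ⊢; nlinarith
  · set s := Real.sign (S q r) with hs
    have h2 : (1 / √2) * (1 / √2) = (1 / 2 : ℝ) := by
      rw [div_mul_div_comm, Real.mul_self_sqrt (by norm_num)]; norm_num
    have hsS : s * S q r = |S q r| := by
      rw [hs]
      rcases lt_trichotomy (S q r) 0 with h | h | h
      · rw [Real.sign_of_neg h, abs_of_neg h]; ring
      · simp [h]
      · rw [Real.sign_of_pos h, abs_of_pos h]; ring
    have e : ((1 / √2) • (Pi.single q 1 - s • Pi.single r 1)) ⬝ᵥ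
        (S *ᵥ ((1 / √2) • (Pi.single q 1 - s • Pi.single r 1))) =
        1 / 2 * (S q q - 2 * |S q r| + s ^ 2 * S r r) := by
      rw [mulVec_smul, dotProduct_smul, smul_dotProduct, smul_smul, h2, ← hsS]
      simp only [mulVec_sub, mulVec_smul, sub_dotProduct, dotProduct_sub, smul_dotProduct,
        dotProduct_smul, mulVec_single_one, single_one_dotProduct, col_apply, smul_eq_mul]
      rw [hS.apply q r]
      ring
    rw [e]
    -- Only `s² ≤ 1` is available, since the sign of zero is zero.
    have hs2 : s ^ 2 * S r r ≤ θ * |S q r| := by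
      have h1 : s ^ 2 ≤ 1 := (sq_le_one_iff_abs_le_one _).2 (abs_sign_le_one _)
      have h0 : 0 ≤ θ * |S q r| := by positivity
      nlinarith [sq_nonneg s, mul_nonneg (sq_nonneg s) (sub_nonneg.2 hr),
        mul_nonneg (sub_nonneg.2 h1) h0]
    linarith

end CurvVec

/-! ### Consequences of the factorization for the KKT matrix. -/

section KKT

variable {α β : Type*} [DecidableEq β]

theorem isSymm_fromBlocks_kkt {H : Matrix α α ℝ} (hH : H.IsSymm) (J : Matrix β α ℝ) (μ : ℝ) :
    (fromBlocks H Jᵀ J (-μ • (1 : Matrix β β ℝ))).IsSymm :=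
  hH.fromBlocks (transpose_transpose J) (by simp [IsSymm])

variable [Fintype α] [Fintype β]

theorem kkt_mulVec_inr (H : Matrix α α ℝ) (J : Matrix β α ℝ) (μ : ℝ) (v : α ⊕ β → ℝ) (j : β) :
    (fromBlocks H Jᵀ J (-μ • (1 : Matrix β β ℝ)) *ᵥ v) (Sum.inr j) =
      (J *ᵥ (v ∘ Sum.inl)) j - μ * v (Sum.inr j) := by
  simp [fromBlocks_mulVec, neg_mulVec, smul_mulVec, sub_eq_add_neg]

theorem kkt_dotProduct (H : Matrix α α ℝ) (J : Matrix β α ℝ) (μ : ℝ) (v : α ⊕ β → ℝ) :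
    v ⬝ᵥ (fromBlocks H Jᵀ J (-μ • (1 : Matrix β β ℝ)) *ᵥ v) =
      (v ∘ Sum.inl) ⬝ᵥ (H *ᵥ (v ∘ Sum.inl)) + 2 * ((v ∘ Sum.inr) ⬝ᵥ (J *ᵥ (v ∘ Sum.inl))) -
        μ * ((v ∘ Sum.inr) ⬝ᵥ (v ∘ Sum.inr)) := by
  have e : v = Sum.elim (v ∘ Sum.inl) (v ∘ Sum.inr) := (Sum.elim_comp_inl_inr v).symm
  conv_lhs => rw [e]
  rw [fromBlocks_mulVec, sumElim_dotProduct_sumElim]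
  simp only [Sum.elim_comp_inl, Sum.elim_comp_inr, dotProduct_add, neg_smul, neg_mulVec,
    smul_mulVec, one_mulVec, dotProduct_neg, dotProduct_smul, smul_eq_mul]
  rw [mulVec_transpose, dotProduct_comm (v ∘ Sum.inl) (_ ᵥ* J), ← dotProduct_mulVec]
  ring

/-- Two consequences of the factorization of a KKT matrix, in terms of the largest entry `ρ` of the
final Schur complement: the curvature of `H` on the null space of `J` is at least of the order
`-ρ`, and the computed direction has size `√ρ` and curvature at most `-(1 - θ) ρ²`. -/
theorem IsCurvSolve.exists_rho [DecidableEq α] {H : Matrix α α ℝ} (hH : H.IsSymm) {J : Matrix β α ℝ} {μ θ Λ : ℝ}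
    (hμ : 0 < μ) (hθ0 : 0 ≤ θ) (hθ1 : θ < 1) {w : α ⊕ β → ℝ}
    (hw : IsCurvSolve (fromBlocks H Jᵀ J (-μ • (1 : Matrix β β ℝ))) θ Λ w) :
    ∃ ρ : ℝ, 0 ≤ ρ ∧
      (∀ a : α → ℝ, J *ᵥ a = 0 → -(ρ * (∑ i, |a i|) ^ 2) ≤ a ⬝ᵥ (H *ᵥ a)) ∧
      (0 < ρ →
        (w ∘ Sum.inl) ⬝ᵥ ((H + (1 / μ) • (Jᵀ * J)) *ᵥ (w ∘ Sum.inl)) ≤ -((1 - θ) * ρ ^ 2) ∧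
        ∀ i, |w (Sum.inl i)| ≤
          (1 + Fintype.card (α ⊕ β) * max 1 Λ) ^ Fintype.card (α ⊕ β) * √ρ) := by
  obtain ⟨R, L, S, hs, hΛ, hR, hcase⟩ := hw
  set K := fromBlocks H Jᵀ J (-μ • (1 : Matrix β β ℝ)) with hKdef
  have hK : K.IsSymm := isSymm_fromBlocks_kkt hH J μ
  have hS := hs.isSymm hK
  have hrow := hs.row_eq_zero
  have hSr : ∀ j b, S (Sum.inr j) b = 0 := fun j => hrow _ (hR j)
  have hSc : ∀ a j, S a (Sum.inr j) = 0 := fun a j => by rw [← hS.apply, hSr]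
  have hSv : ∀ a, (∀ b, S a b = 0) → ∀ v, (S *ᵥ v) a = 0 := fun a ha v => by
    simp [mulVec, dotProduct, ha]
  -- the quadratic form of the Schur complement only sees the `H`-rows
  have hSq : ∀ v : α ⊕ β → ℝ, v ⬝ᵥ (S *ᵥ v) =
      (v ∘ Sum.inl) ⬝ᵥ (S.submatrix Sum.inl Sum.inl *ᵥ (v ∘ Sum.inl)) := fun v => by
    simp [dotProduct, mulVec, Fintype.sum_sum_type, hSr, hSc]
  have hpsd : ∀ ρ, (∀ a b, |S a b| ≤ ρ) → ∀ a : α → ℝ, J *ᵥ a = 0 →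
      -(ρ * (∑ i, |a i|) ^ 2) ≤ a ⬝ᵥ (H *ᵥ a) := by
    intro ρ hρ a ha
    obtain ⟨W, hW, hWS⟩ := hs.exists_submodule hK
    -- A vector of `W` with zero `H`-part has `S`-form `0` and `K`-form `-μ ‖b‖²`; the inequality on
    -- `W` forces `b = 0`. With the dimension count the projection of `W` is bijective.
    have hinj : Function.Injective
        ((LinearMap.funLeft ℝ ℝ (Sum.inl : α → α ⊕ β)) ∘ₗ W.subtype) := by
      rw [← LinearMap.ker_eq_bot, LinearMap.ker_eq_bot']
      rintro ⟨v, hv⟩ h0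
      have hv0 : v ∘ Sum.inl = 0 := h0
      have h1 := hWS v hv
      rw [hSq, kkt_dotProduct, hv0] at h1
      simp only [mulVec_zero, dotProduct_zero] at h1
      have h2 : (v ∘ Sum.inr) ⬝ᵥ (v ∘ Sum.inr) ≤ 0 := by
        by_contra hcon
        have := mul_pos hμ (not_le.1 hcon)
        linarith
      have h3 : v ∘ Sum.inr = 0 := dotProduct_self_eq_zero.1
        (le_antisymm h2 (Finset.sum_nonneg fun _ _ => mul_self_nonneg _))
      ext p
      rcases p with i | j
      · exact congrFun hv0 i
      · exact congrFun h3 j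
    have hfr : Module.finrank ℝ W = Module.finrank ℝ (α → ℝ) := by
      refine le_antisymm (LinearMap.finrank_le_finrank_of_injective hinj) ?_
      rw [Module.finrank_fintype_fun_eq_card]
      exact (Nat.le_add_right _ _).trans hW
    -- Lift `a` to some `(a, b) ∈ W`: as `J a = 0`, its `K`-form is `aᵀ H a - μ ‖b‖²`, and its
    -- `S`-form depends on `a` only.
    obtain ⟨⟨v, hv⟩, hva⟩ :=
      (LinearMap.injective_iff_surjective_of_finrank_eq_finrank hfr).1 hinj a
    have hva' : v ∘ Sum.inl = a := hva
    have h1 := hWS v hv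
    rw [hSq, kkt_dotProduct, hva', ha, dotProduct_zero] at h1
    have h2 := neg_mul_sq_sum_abs_le (S := S.submatrix Sum.inl Sum.inl) (fun i j => hρ _ _) a
    have h3 : 0 ≤ μ * ((v ∘ Sum.inr) ⬝ᵥ (v ∘ Sum.inr)) :=
      mul_nonneg hμ.le (Finset.sum_nonneg fun _ _ => mul_self_nonneg _)
    linarith
  rcases hcase with ⟨rfl, _⟩ | ⟨q, hq, r, hr, hmax, hdiag, hsol⟩
  · refine ⟨0, le_rfl, hpsd 0 fun a b => ?_, fun h => (lt_irrefl _ h).elim⟩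
    simp [hrow a (Finset.notMem_empty a) b]
  set ρ := |S q r| with hρ
  have hρ0 : 0 ≤ ρ := abs_nonneg _
  have hmax' : ∀ a b, |S a b| ≤ ρ := by
    intro a b
    by_cases ha : a ∈ R
    · by_cases hb : b ∈ R
      · exact hmax a ha b hb
      · rw [← hS.apply, hrow b hb]; simpa using hρ0
    · rw [hrow a ha]; simpa using hρ0
  refine ⟨ρ, hρ0, hpsd ρ hmax', fun _ => ⟨?_, ?_⟩⟩
  · have hLw : ∀ p ∉ R, (Lᵀ *ᵥ w) p = 0 := fun p hp => by
      have h1 : p ≠ q := fun h => hp (h ▸ hq)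
      have h2 : p ≠ r := fun h => hp (h ▸ hr)
      rw [hsol, Pi.smul_apply, curvVec_eq_zero S h1 h2, smul_zero]
    have hKw : K *ᵥ w = S *ᵥ w := hs.mulVec_eq hK w hLw
    have hwR : ∀ p ∈ R, w p = √ρ * curvVec S q r p := fun p hp => by
      rw [← hs.transpose_mulVec_apply w hp, hsol]; rfl
    have hSw : S *ᵥ w = √ρ • (S *ᵥ curvVec S q r) := by
      rw [← mulVec_smul]
      ext a
      simp only [mulVec, dotProduct]
      refine Finset.sum_congr rfl fun p _ => ?_
      by_cases hp : p ∈ R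
      · rw [hwR p hp]; rfl
      · rw [← hS.apply, hrow p hp]; simp
    -- `w` differs from `√ρ h` only at eliminated indices, where the rows and columns of `S` vanish.
    have hwSw : w ⬝ᵥ (S *ᵥ w) = ρ * (curvVec S q r ⬝ᵥ (S *ᵥ curvVec S q r)) := by
      have : w ⬝ᵥ (S *ᵥ w) = (√ρ • curvVec S q r) ⬝ᵥ (S *ᵥ w) := by
        refine Finset.sum_congr rfl fun p _ => ?_
        by_cases hp : p ∈ R
        · rw [hwR p hp]; rfl
        · have : (S *ᵥ w) p = 0 := hSv p (hrow p hp) w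
          rw [this, mul_zero, mul_zero]
      rw [this, hSw, smul_dotProduct, dotProduct_smul, smul_smul, Real.mul_self_sqrt hρ0,
        smul_eq_mul]
    -- The `D`-rows of `K w = S w` are zero, which gives `b = J a / μ` and turns the `K`-form into
    -- that of `H + Jᵀ J / μ`.
    have hb : ∀ j, w (Sum.inr j) = (1 / μ) * (J *ᵥ (w ∘ Sum.inl)) j := fun j => by
      have h1 : (K *ᵥ w) (Sum.inr j) = 0 := by
        rw [hKw]
        exact hSv _ (hSr j) w
      rw [kkt_mulVec_inr] at h1
      field_simp
      linarith
    have hb' : w ∘ Sum.inr = (1 / μ) • (J *ᵥ (w ∘ Sum.inl)) := funext hb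
    have hquad : (w ∘ Sum.inl) ⬝ᵥ ((H + (1 / μ) • (Jᵀ * J)) *ᵥ (w ∘ Sum.inl)) =
        w ⬝ᵥ (K *ᵥ w) := by
      rw [kkt_dotProduct, hb', add_mulVec, dotProduct_add, smul_mulVec, dotProduct_smul,
        ← mulVec_mulVec, mulVec_transpose, dotProduct_comm (w ∘ Sum.inl) (_ ᵥ* J),
        ← dotProduct_mulVec]
      simp only [smul_dotProduct, dotProduct_smul, smul_eq_mul]
      field_simp
      ring
    rw [hquad, hKw, hwSw]
    have := mul_le_mul_of_nonneg_left
      (curvVec_dotProduct_le hS hθ0 hθ1 (hdiag q hq) (hdiag r hr)) hρ0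
    rw [← hρ] at this
    linarith
  · intro i
    have hΛ' : ∀ a b, |L a b| ≤ max 1 Λ := fun a b => (hΛ a b).trans (le_max_right _ _)
    refine (hs.abs_le (le_max_left 1 Λ) w hΛ' (√ρ) (Real.sqrt_nonneg _) (fun p => ?_) _).trans ?_
    · rw [hsol, Pi.smul_apply, smul_eq_mul, abs_mul, abs_of_nonneg (Real.sqrt_nonneg _)]
      exact mul_le_of_le_one_right (Real.sqrt_nonneg _) (abs_curvVec_le_one _ _ _ _)
    · refine mul_le_mul_of_nonneg_right (pow_le_pow_right₀ ?_ (Nat.sub_le _ _))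
        (Real.sqrt_nonneg _)
      have : 0 ≤ max 1 Λ := zero_le_one.trans (le_max_left _ _)
      exact le_add_of_nonneg_right (by positivity)

end KKT

/-! ### Restriction to the free variables -/

section Restrict

variable {ι κ : Type*} [Fintype ι] [DecidableEq ι] {W : Finset ι} {d : ι → ℝ}

theorem sum_compl_subtype {g : ι → ℝ} (hg : ∀ i ∈ W, g i = 0) :
    ∑ i : {i // i ∉ W}, g i.1 = ∑ i, g i := by
  rw [← Finset.sum_subtype (Finset.univ \ W) (p := fun i => i ∉ W) (by simp)]
  exact Finset.sum_subset (Finset.subset_univ _) fun i _ hi => hg i (by simpa using hi)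

theorem submatrix_mulVec_restrict (hd : ∀ i ∈ W, d i = 0) (J : Matrix κ ι ℝ) :
    J.submatrix id (Subtype.val : {i // i ∉ W} → ι) *ᵥ (fun i => d i.1) = J *ᵥ d := by
  ext j
  exact sum_compl_subtype (g := fun i => J j i * d i) fun i hi => by simp [hd i hi]

theorem dotProduct_submatrix_restrict (hd : ∀ i ∈ W, d i = 0) (H : Matrix ι ι ℝ) :
    (fun i : {i // i ∉ W} => d i) ⬝ᵥ
      (H.submatrix Subtype.val Subtype.val *ᵥ fun i : {i // i ∉ W} => d i) = d ⬝ᵥ (H *ᵥ d) := by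
  have h : ∀ i : {i // i ∉ W},
      (H.submatrix Subtype.val Subtype.val *ᵥ fun i : {i // i ∉ W} => d i) i = (H *ᵥ d) i.1 :=
    fun i => congrFun (submatrix_mulVec_restrict hd H) i.1
  simp only [dotProduct, h]
  exact sum_compl_subtype (g := fun i => d i * (H *ᵥ d) i) fun i hi => by simp [hd i hi]

end Restrict

/-- The curvature of the Lagrangian Hessian on the null space of the Jacobian, within the free
variables, is bounded below in terms of the curvature along the computed direction. -/
theorem IsCurvDir.neg_le_dotProduct {n m : ℕ} {f : E n → ℝ} {c : E n → E m} {θ Λ μ t ω : ℝ}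
    {x : E n} {y : E m} {u : E n} (hH : (lagHess f c x y).IsSymm) (hμ : 0 < μ) (hθ0 : 0 ≤ θ)
    (hθ1 : θ < 1) (hu : IsCurvDir f c θ Λ μ t x y u) (hω0 : 0 ≤ ω)
    (hω : -curvature f c μ x y u ≤ ω) {d : Fin n → ℝ} (hd : ∀ i ∈ workSet t x, d i = 0)
    (hJd : jac c x *ᵥ d = 0) :
    -(n * ((1 + (n + m) * max 1 Λ) ^ (n + m)) ^ 2 / (1 - θ) * ω * (∑ i, |d i|) ^ 2) ≤
      d ⬝ᵥ (lagHess f c x y *ᵥ d) := by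
  obtain ⟨hu0, w, hw, huw⟩ := hu
  set D : ℝ := (1 + (n + m) * max 1 Λ) ^ (n + m) with hD
  have hθ' : 0 < 1 - θ := sub_pos.2 hθ1
  have hΛ : 0 ≤ max 1 Λ := zero_le_one.trans (le_max_left _ _)
  have hD0 : 0 ≤ D := by positivity
  obtain ⟨ρ, hρ0, hlow, hcurv⟩ := IsCurvSolve.exists_rho (hH.submatrix _) hμ hθ0 hθ1 hw
  have huw' : w ∘ Sum.inl = fun i => u.ofLp i.1 := funext fun i => (huw i).symm
  have hlow' := hlow (fun i => d i.1) (by rw [submatrix_mulVec_restrict hd, hJd])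
  rw [dotProduct_submatrix_restrict hd] at hlow'
  have hsum : ∑ i : Free t x, |d i.1| = ∑ i, |d i| :=
    sum_compl_subtype (g := fun i => |d i|) fun i hi => by simp [hd i hi]
  rw [hsum] at hlow'
  refine le_trans (neg_le_neg ?_) hlow'
  refine mul_le_mul_of_nonneg_right ?_ (sq_nonneg _)
  rcases hρ0.eq_or_lt with rfl | hρ
  · positivity
  obtain ⟨hq, hsize⟩ := hcurv hρ
  -- Replacing the number of free variables by `n` makes the constant the same for all iterates.
  have hcard : Fintype.card (Free t x ⊕ Fin m) ≤ n + m := by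
    rw [Fintype.card_sum, Fintype.card_fin]
    have := Fintype.card_subtype_le fun i : Fin n => i ∉ workSet t x
    rw [Fintype.card_fin] at this
    exact Nat.add_le_add_right this m
  have hDle : (1 + Fintype.card (Free t x ⊕ Fin m) * max 1 Λ) ^
      Fintype.card (Free t x ⊕ Fin m) ≤ D := by
    have hc : (Fintype.card (Free t x ⊕ Fin m) : ℝ) ≤ n + m := by exact_mod_cast hcard
    have h1 : 1 + Fintype.card (Free t x ⊕ Fin m) * max 1 Λ ≤ 1 + (n + m) * max 1 Λ := by
      gcongr
    exact (pow_le_pow_left₀ (by positivity) h1 _).trans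
      (pow_le_pow_right₀ (le_add_of_nonneg_right (by positivity)) hcard)
  have hui : ∀ i, |u i| ≤ D * √ρ := fun i => by
    by_cases hi : i ∈ workSet t x
    · rw [hu0 i hi, abs_zero]; positivity
    · rw [huw ⟨i, hi⟩]
      exact (hsize ⟨i, hi⟩).trans (mul_le_mul_of_nonneg_right hDle (Real.sqrt_nonneg _))
  have hnorm : ‖u‖ ^ 2 ≤ n * (D ^ 2 * ρ) := by
    rw [EuclideanSpace.norm_sq_eq]
    refine (Finset.sum_le_card_nsmul _ _ (D ^ 2 * ρ) fun i _ => ?_).trans_eq (by simp)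
    rw [Real.norm_eq_abs]
    calc |u i| ^ 2 ≤ (D * √ρ) ^ 2 := pow_le_pow_left₀ (abs_nonneg _) (hui i) 2
      _ = D ^ 2 * ρ := by rw [mul_pow, Real.sq_sqrt hρ0]
  set q := u.ofLp ⬝ᵥ ((lagHess f c x y + (1 / μ) • ((jac c x)ᵀ * jac c x)) *ᵥ u.ofLp) with hqdef
  have hq' : q ≤ -((1 - θ) * ρ ^ 2) := by
    rw [hqdef, ← dotProduct_submatrix_restrict hu0]
    rw [huw'] at hq
    exact hq
  have hq0 : q < 0 := lt_of_le_of_lt hq' (neg_neg_of_pos (by positivity))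
  have hu_ne : u ≠ 0 := by
    rintro rfl
    simp [hqdef] at hq0
  have hupos : 0 < ‖u‖ ^ 2 := by positivity
  -- The chain is `(1 - θ) ρ² ≤ -q ≤ ω ‖u‖² ≤ n D² ω ρ`; one factor `ρ` then cancels.
  have h1 : -q ≤ ω * ‖u‖ ^ 2 := by
    rw [← div_le_iff₀ hupos, neg_div]
    exact hω
  have h2 : (1 - θ) * ρ * ρ ≤ n * D ^ 2 * ω * ρ := by
    nlinarith [mul_le_mul_of_nonneg_left hnorm hω0]
  rw [div_mul_eq_mul_div, le_div_iff₀ hθ']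
  linarith [le_of_mul_le_mul_right h2 hρ]

/-! ### Smoothness of the Lagrangian Hessian -/

theorem hess_isSymm {n : ℕ} {φ : E n → ℝ} (hφ : ContDiff ℝ 2 φ) (x : E n) :
    (hess φ x).IsSymm := by
  ext i j
  exact (hφ.contDiffAt.isSymmSndFDerivAt (by simp)) _ _

theorem continuous_hess {n : ℕ} {φ : E n → ℝ} (hφ : ContDiff ℝ 2 φ) :
    Continuous fun x => hess φ x := by
  have h : ContDiff ℝ 1 (fderiv ℝ φ) := hφ.fderiv_right (by norm_num)
  have h' := h.continuous_fderiv one_ne_zero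
  refine continuous_matrix fun i j => ?_
  exact (h'.clm_apply continuous_const).clm_apply continuous_const

theorem continuous_jac {n m : ℕ} {c : E n → E m} (hc : ContDiff ℝ 2 c) :
    Continuous fun x => jac c x := by
  have h := hc.continuous_fderiv two_ne_zero
  refine continuous_matrix fun i j => ?_
  have h1 : Continuous fun x => fderiv ℝ c x (EuclideanSpace.single j 1) :=
    h.clm_apply continuous_const
  exact (EuclideanSpace.proj i).continuous.comp h1

theorem contDiff_component {n m : ℕ} {c : E n → E m} (hc : ContDiff ℝ 2 c) (i : Fin m) :
    ContDiff ℝ 2 fun z => c z i :=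
  (EuclideanSpace.proj (𝕜 := ℝ) i).contDiff.comp hc

theorem contDiff_lagrangian {n m : ℕ} {f : E n → ℝ} {c : E n → E m} (hf : ContDiff ℝ 2 f)
    (hc : ContDiff ℝ 2 c) (y : E m) : ContDiff ℝ 2 fun z => f z - ∑ i, y i * c z i :=
  hf.sub (ContDiff.sum fun i _ => contDiff_const.mul (contDiff_component hc i))

/-- Writing out the dependence on `y` reduces joint continuity in `(x, y)` to continuity of the
individual Hessians. -/
theorem lagHess_eq {n m : ℕ} {f : E n → ℝ} {c : E n → E m} (hf : ContDiff ℝ 2 f)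
    (hc : ContDiff ℝ 2 c) (x : E n) (y : E m) :
    lagHess f c x y = hess f x - ∑ i, y i • hess (fun z => c z i) x := by
  have hci := contDiff_component hc
  have h1 : fderiv ℝ (fun z => f z - ∑ i, y i * c z i) =
      fun z => fderiv ℝ f z - ∑ i, y i • fderiv ℝ (fun z => c z i) z := funext fun z =>
    ((hf.differentiable two_ne_zero z).hasFDerivAt.sub (HasFDerivAt.fun_sum fun i _ =>
      ((hci i).differentiable two_ne_zero z).hasFDerivAt.const_mul (y i))).fderiv
  have hd : ∀ {φ : E n → ℝ}, ContDiff ℝ 2 φ →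
      HasFDerivAt (fderiv ℝ φ) (fderiv ℝ (fderiv ℝ φ) x) x := fun {φ} hφ => by
    have h : ContDiff ℝ 1 (fderiv ℝ φ) := hφ.fderiv_right (by norm_num)
    exact (h.differentiable one_ne_zero x).hasFDerivAt
  have h2 := ((hd hf).sub (HasFDerivAt.fun_sum (u := Finset.univ) fun i _ =>
    (hd (hci i)).const_smul (y i))).fderiv
  ext a b
  simp only [lagHess, hess, h1]
  erw [h2]
  simp [Matrix.sum_apply, hess]

/-! ### Null spaces of matrices of constant rank -/

theorem norm_sub_mulVec_le {ι κ : Type*} [Fintype ι] [Fintype κ] (M N : Matrix ι κ ℝ)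
    (v : κ → ℝ) : ‖M *ᵥ v - N *ᵥ v‖ ≤ (∑ i, ∑ j, |M i j - N i j|) * ‖v‖ := by
  have h0 : 0 ≤ ∑ i, ∑ j, |M i j - N i j| := by positivity
  refine (pi_norm_le_iff_of_nonneg (by positivity)).2 fun i => ?_
  have h1 : (M *ᵥ v - N *ᵥ v) i = ∑ j, (M i j - N i j) * v j := by
    simp [mulVec, dotProduct, sub_mul]
  rw [h1, Real.norm_eq_abs]
  calc |∑ j, (M i j - N i j) * v j| ≤ ∑ j, |M i j - N i j| * ‖v‖ := by
        refine (Finset.abs_sum_le_sum_abs _ _).trans (Finset.sum_le_sum fun j _ => ?_)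
        rw [abs_mul]
        exact mul_le_mul_of_nonneg_left (norm_le_pi_norm v j) (abs_nonneg _)
    _ = (∑ j, |M i j - N i j|) * ‖v‖ := by rw [Finset.sum_mul]
    _ ≤ _ := mul_le_mul_of_nonneg_right
        (Finset.single_le_sum (f := fun i => ∑ j, |M i j - N i j|)
          (fun i _ => by positivity) (Finset.mem_univ i)) (norm_nonneg v)

theorem finrank_ker_add_rank {ι κ : Type*} [Fintype ι] [Fintype κ] (M : Matrix ι κ ℝ) :
    Module.finrank ℝ (LinearMap.ker M.mulVecLin) + M.rank = Fintype.card κ := by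
  have := M.mulVecLin.finrank_range_add_finrank_ker
  rw [Module.finrank_fintype_fun_eq_card] at this
  rw [Matrix.rank]
  omega

/-- If matrices of constant rank converge, every null vector of the limit is a limit of null
vectors. -/
theorem exists_tendsto_mulVec_eq_zero {ι κ ν : Type*} [Fintype ι] [Fintype κ] {l : Filter ν}
    {M : ν → Matrix ι κ ℝ} {M₀ : Matrix ι κ ℝ} (hM : Tendsto M l (𝓝 M₀))
    (hr : ∀ᶠ k in l, (M k).rank = M₀.rank) {d : κ → ℝ} (hd : M₀ *ᵥ d = 0) :
    ∃ z : ν → κ → ℝ, Tendsto z l (𝓝 d) ∧ ∀ᶠ k in l, M k *ᵥ z k = 0 := by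
  -- `M₀` is bounded below on a complement `C` of its kernel, and this persists for nearby `M k`
  -- with twice the constant.
  obtain ⟨C, hC⟩ := (LinearMap.ker M₀.mulVecLin).exists_isCompl
  have hker : LinearMap.ker (M₀.mulVecLin ∘ₗ C.subtype) = ⊥ := by
    rw [LinearMap.ker_eq_bot']
    rintro ⟨v, hv⟩ h
    exact Subtype.ext (Submodule.disjoint_def.1 hC.disjoint v h hv)
  obtain ⟨κ', _, hκ⟩ := LinearMap.exists_antilipschitzWith _ hker
  have hanti : ∀ v ∈ C, ‖v‖ ≤ κ' * ‖M₀ *ᵥ v‖ := fun v hv => by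
    simpa using hκ.le_mul_norm_sub ⟨v, hv⟩ 0
  set e : ν → ℝ := fun k => ∑ i, ∑ j, |M k i j - M₀ i j| with he
  have hetend : Tendsto e l (𝓝 0) := by
    have : Tendsto e l (𝓝 (∑ i, ∑ j, |M₀ i j - M₀ i j|)) := by
      refine tendsto_finsetSum _ fun i _ => tendsto_finsetSum _ fun j _ => ?_
      have hij : Tendsto (fun k => M k i j) l (𝓝 (M₀ i j)) :=
        ((continuous_id.matrix_elem i j).tendsto M₀).comp hM
      exact (hij.sub tendsto_const_nhds).abs
    simpa using this
  have hsmall : ∀ᶠ k in l, κ' * e k ≤ 1 / 2 := by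
    have : Tendsto (fun k => κ' * e k) l (𝓝 0) := by simpa using hetend.const_mul (κ' : ℝ)
    exact (this.eventually_lt_const (by norm_num : (0 : ℝ) < 1 / 2)).mono fun _ => le_of_lt
  have hbound : ∀ k, κ' * e k ≤ 1 / 2 → ∀ v ∈ C, ‖v‖ ≤ 2 * κ' * ‖M k *ᵥ v‖ := by
    intro k hk v hv
    have h1 := hanti v hv
    have h2 := norm_sub_mulVec_le (M k) M₀ v
    have h3 : ‖M₀ *ᵥ v‖ ≤ ‖M k *ᵥ v‖ + e k * ‖v‖ := by
      have := norm_sub_norm_le (M₀ *ᵥ v) (M k *ᵥ v)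
      rw [norm_sub_rev] at this
      linarith
    have h4 := mul_le_mul_of_nonneg_left h3 κ'.coe_nonneg
    have h5 := mul_le_mul_of_nonneg_right hk (norm_nonneg v)
    linarith
  have hex : ∀ k, ∃ z, κ' * e k ≤ 1 / 2 → (M k).rank = M₀.rank →
      M k *ᵥ z = 0 ∧ ‖z - d‖ ≤ 2 * κ' * (e k * ‖d‖) := by
    intro k
    by_cases hk : κ' * e k ≤ 1 / 2 ∧ (M k).rank = M₀.rank
    swap
    · exact ⟨0, fun h1 h2 => (hk ⟨h1, h2⟩).elim⟩
    have hdisj : Disjoint (LinearMap.ker (M k).mulVecLin) C := by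
      rw [Submodule.disjoint_def]
      intro v hv hvC
      have hv' : M k *ᵥ v = 0 := hv
      have := hbound k hk.1 v hvC
      rw [hv', norm_zero, mul_zero] at this
      exact norm_le_zero_iff.1 this
    -- Equal ranks give kernels of equal dimension, so `C` is also a complement of the kernel of `M
    -- k`.
    have htop : LinearMap.ker (M k).mulVecLin ⊔ C = ⊤ := by
      refine Submodule.eq_top_of_disjoint _ _ ?_ hdisj
      have h1 := Submodule.finrank_add_eq_of_isCompl hC
      have h2 := finrank_ker_add_rank (M k)
      have h3 := finrank_ker_add_rank M₀
      rw [Module.finrank_fintype_fun_eq_card] at h1 ⊢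
      have := hk.2
      omega
    -- Split `d = z + v` along this decomposition: `M k v = (M k - M₀) d` is small, hence so is `v ∈
    -- C`.
    obtain ⟨z, hz, v, hv, hzv⟩ := Submodule.mem_sup.1 (htop ▸ Submodule.mem_top : d ∈ _)
    have hz' : M k *ᵥ z = 0 := hz
    refine ⟨z, fun _ _ => ⟨hz', ?_⟩⟩
    have h1 := hbound k hk.1 v hv
    have h2 : M k *ᵥ v = M k *ᵥ d - M₀ *ᵥ d := by
      rw [hd, sub_zero, ← hzv, mulVec_add, hz', zero_add]
    have h3 : z - d = -v := by rw [← hzv]; abel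
    rw [h3, norm_neg]
    refine h1.trans (mul_le_mul_of_nonneg_left ?_ (by positivity))
    rw [h2]
    exact norm_sub_mulVec_le _ _ _
  choose z hz using hex
  refine ⟨z, ?_, ?_⟩
  · rw [tendsto_iff_norm_sub_tendsto_zero]
    have hlim : Tendsto (fun k => 2 * κ' * (e k * ‖d‖)) l (𝓝 0) := by
      simpa using (hetend.mul_const ‖d‖).const_mul (2 * κ' : ℝ)
    refine squeeze_zero' (Eventually.of_forall fun _ => norm_nonneg _) ?_ hlim
    filter_upwards [hsmall, hr] with k h1 h2 using (hz k h1 h2).2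
  · filter_upwards [hsmall, hr] with k h1 h2 using (hz k h1 h2).1

/-! ### S- and L-iterates -/

/-- The limit `s` exists by monotonicity, and infinitely many halvings force `s ≤ s / 2`. -/
theorem tendsto_zero_of_frequently_halved {a : ℕ → ℝ} (ha : Antitone a) (h0 : ∀ k, 0 < a k)
    (hf : ∃ᶠ k in atTop, a (k + 1) = 1 / 2 * a k) : Tendsto a atTop (𝓝 0) := by
  have hb : BddBelow (Set.range a) := ⟨0, by rintro _ ⟨k, rfl⟩; exact (h0 k).le⟩
  have hlim := tendsto_atTop_ciInf ha hb
  have hs0 : 0 ≤ ⨅ k, a k := le_ciInf fun k => (h0 k).le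
  have h1 : Tendsto (fun k => a (k + 1) - 1 / 2 * a k) atTop
      (𝓝 ((⨅ k, a k) - 1 / 2 * ⨅ k, a k)) :=
    (hlim.comp (tendsto_add_atTop_nat 1)).sub (hlim.const_mul _)
  have h2 := le_of_tendsto_of_frequently h1 (hf.mono fun k hk => (sub_eq_zero.2 hk).le)
  have h3 : ⨅ k, a k = 0 := by linarith
  rwa [h3] at hlim

section Run

variable {n m : ℕ} {f : E n → ℝ} {c : E n → E m} (r : Run f c)

theorem Run.isL_update {k : ℕ} (h : r.IsL (k + 1)) :
    r.maxS (k + 1) = r.maxS k ∧ r.maxL (k + 1) = 1 / 2 * r.maxL k :=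
  r.update_L k h.1 h.2

theorem Run.update_cases (k : ℕ) :
    (r.maxS (k + 1) = 1 / 2 * r.maxS k ∨ r.maxS (k + 1) = r.maxS k) ∧
      (r.maxL (k + 1) = 1 / 2 * r.maxL k ∨ r.maxL (k + 1) = r.maxL k) := by
  by_cases hS : r.IsS (k + 1)
  · exact ⟨.inl (r.update_S k hS).1, .inr (r.update_S k hS).2⟩
  by_cases hL : r.IsL (k + 1)
  · exact ⟨.inr (r.isL_update hL).1, .inl (r.isL_update hL).2⟩
  · have := r.update_other k hS fun h => hL ⟨hS, h⟩
    exact ⟨.inr this.1, .inr this.2⟩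

theorem Run.maxS_pos (k : ℕ) : 0 < r.maxS k := by
  induction k with
  | zero => exact r.maxS_zero
  | succ k ih => rcases (r.update_cases k).1 with h | h <;> rw [h] <;> linarith

theorem Run.maxL_pos (k : ℕ) : 0 < r.maxL k := by
  induction k with
  | zero => exact r.maxL_zero
  | succ k ih => rcases (r.update_cases k).2 with h | h <;> rw [h] <;> linarith

theorem Run.antitone_maxS : Antitone r.maxS :=
  antitone_nat_of_succ_le fun k => by
    have := r.maxS_pos k
    rcases (r.update_cases k).1 with h | h <;> rw [h]; linarith

theorem Run.antitone_maxL : Antitone r.maxL :=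
  antitone_nat_of_succ_le fun k => by
    have := r.maxL_pos k
    rcases (r.update_cases k).2 with h | h <;> rw [h]; linarith

/-- Since `η ≥ 0`, `φ_S` dominates `10⁻⁵ ω`; half the old maximum is the new one, so the bound
carries the index `k` itself. -/
theorem Run.omega_le_of_isS {k : ℕ} (h : r.IsS k) :
    omega f c (r.μ k) (r.x k) (r.y k) (r.u k) ≤ 10 ^ 5 * r.maxS k := by
  cases k with
  | zero => exact h.elim
  | succ k =>
    have h1 : phiS f c (r.μ (k+1)) (r.x (k+1)) (r.y (k+1)) (r.u (k+1)) ≤ 1 / 2 * r.maxS k := h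
    rw [← (r.update_S k h).1, phiS] at h1
    have : 0 ≤ eta c (r.x (k+1)) := norm_nonneg _
    linarith

theorem Run.omega_le_of_isL {k : ℕ} (h : r.IsL k) :
    omega f c (r.μ k) (r.x k) (r.y k) (r.u k) ≤ r.maxL k := by
  cases k with
  | zero => exact h.elim
  | succ k =>
    have h1 := h.2
    rw [← (r.isL_update h).2, phiL] at h1
    have : 0 ≤ eta c (r.x (k+1)) := norm_nonneg _
    linarith

theorem frequently_succ_of_comp {P : ℕ → Prop} {σ : ℕ → ℕ} (hσ : StrictMono σ)
    (h : ∃ᶠ j in atTop, P (σ j)) : ∃ᶠ k in atTop, P (k + 1) := by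
  rw [frequently_atTop] at h ⊢
  intro N
  -- `N + 1` rather than `N`, so that `σ j` has a predecessor and this predecessor is at least `N`.
  obtain ⟨j, hj, hP⟩ := h (N + 1)
  obtain ⟨k, hk⟩ := Nat.exists_eq_add_one_of_ne_zero
    (Nat.ne_of_gt ((Nat.succ_pos N).trans_le (hj.trans (hσ.id_le j))))
  have h2 : N + 1 ≤ σ j := hj.trans (hσ.id_le j)
  exact ⟨k, by omega, hk ▸ hP⟩

/-- Along any sequence of S- and L-iterates, the optimality measure becomes arbitrarily small. -/
theorem Run.frequently_omega_le {σ : ℕ → ℕ} (hσ : StrictMono σ)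
    (hSL : ∀ j, r.IsS (σ j) ∨ r.IsL (σ j)) {ε : ℝ} (hε : 0 < ε) :
    ∃ᶠ j in atTop,
      omega f c (r.μ (σ j)) (r.x (σ j)) (r.y (σ j)) (r.u (σ j)) ≤ ε := by
  -- One of the two types occurs infinitely often, and its maximum is then halved infinitely often.
  rcases frequently_or_distrib.1 (Frequently.of_forall (f := atTop) hSL) with h | h
  · have ht := tendsto_zero_of_frequently_halved r.antitone_maxS r.maxS_pos
      ((frequently_succ_of_comp hσ h).mono fun k hk => (r.update_S k hk).1)
    have hev := (ht.comp hσ.tendsto_atTop).eventually_lt_const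
      (by positivity : 0 < ε / 10 ^ 5)
    refine (h.and_eventually hev).mono fun j hj => (r.omega_le_of_isS hj.1).trans ?_
    have : r.maxS (σ j) < ε / 10 ^ 5 := hj.2
    rw [lt_div_iff₀ (by positivity)] at this
    linarith
  · have ht := tendsto_zero_of_frequently_halved r.antitone_maxL r.maxL_pos
      ((frequently_succ_of_comp hσ h).mono fun k hk => (r.isL_update hk).2)
    have hev := (ht.comp hσ.tendsto_atTop).eventually_lt_const hε
    exact (h.and_eventually hev).mono fun j hj => (r.omega_le_of_isL hj.1).trans hj.2.le

end Run

/-! ### The Jacobian of the active constraints. -/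

theorem activeJac_mulVec_eq_zero_iff {n m : ℕ} (c : E n → E m) (x z : E n) (d : Fin n → ℝ) :
    activeJac c x z *ᵥ d = 0 ↔ jac c z *ᵥ d = 0 ∧ ∀ i, x i = 0 → d i = 0 := by
  have h : activeJac c x z *ᵥ d =
      Sum.elim (jac c z *ᵥ d) (fun a : {i : Fin n // x i = 0} => d a.1) := by
    ext (i | a)
    · rfl
    · exact single_one_dotProduct _ _
  rw [h, ← Sum.elim_zero_zero, Sum.elim_eq_iff]
  exact and_congr_right fun _ => funext_iff.trans Subtype.forall

theorem continuous_activeJac {n m : ℕ} {c : E n → E m} (hc : ContDiff ℝ 2 c) (x : E n) :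
    Continuous fun z => activeJac c x z := by
  refine continuous_matrix fun i j => ?_
  rcases i with i | a
  · exact (continuous_jac hc).matrix_elem i j
  · exact continuous_const

/-! ### Passage to the limit -/

theorem neg_curvature_le_omega {n m : ℕ} (f : E n → ℝ) (c : E n → E m) (μ : ℝ) (x : E n) (y : E m)
    (u : E n) : -curvature f c μ x y u ≤ omega f c μ x y u :=
  le_max_right _ _

theorem lagHess_isSymm {n m : ℕ} {f : E n → ℝ} {c : E n → E m} (hf : ContDiff ℝ 2 f)
    (hc : ContDiff ℝ 2 c) (x : E n) (y : E m) : (lagHess f c x y).IsSymm :=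
  hess_isSymm (contDiff_lagrangian hf hc y) x

theorem tendsto_lagHess {n m : ℕ} {f : E n → ℝ} {c : E n → E m} (hf : ContDiff ℝ 2 f)
    (hc : ContDiff ℝ 2 c) {ν : Type*} {l : Filter ν} {x : ν → E n} {y : ν → E m} {x₀ : E n}
    {y₀ : E m} (hx : Tendsto x l (𝓝 x₀)) (hy : Tendsto y l (𝓝 y₀)) :
    Tendsto (fun k => lagHess f c (x k) (y k)) l (𝓝 (lagHess f c x₀ y₀)) := by
  simp only [lagHess_eq hf hc]
  have hcomp : ∀ {φ : E n → ℝ}, ContDiff ℝ 2 φ →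
      Tendsto (fun k => hess φ (x k)) l (𝓝 (hess φ x₀)) := fun hφ =>
    ((continuous_hess hφ).tendsto x₀).comp hx
  refine (hcomp hf).sub (tendsto_finsetSum _ fun i _ => ?_)
  have hyi : Tendsto (fun k => y k i) l (𝓝 (y₀ i)) :=
    ((EuclideanSpace.proj (𝕜 := ℝ) i).continuous.tendsto y₀).comp hy
  exact hyi.smul (hcomp (contDiff_component hc i))

/-- Near a nonnegative limit, the active-set estimate only contains active variables. -/
theorem eventually_workSet_active {n : ℕ} {ν : Type*} {l : Filter ν} {t : ν → ℝ} {x : ν → E n}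
    {x₀ : E n} (ht : Tendsto t l (𝓝 0)) (hx : Tendsto x l (𝓝 x₀)) (h₀ : ∀ i, 0 ≤ x₀ i) :
    ∀ᶠ k in l, ∀ i ∈ workSet (t k) (x k), x₀ i = 0 := by
  rw [eventually_all]
  intro i
  by_cases hi : x₀ i = 0
  · exact Eventually.of_forall fun _ _ => hi
  have hpos : 0 < x₀ i := lt_of_le_of_ne (h₀ i) (Ne.symm hi)
  have hxi : Tendsto (fun k => x k i) l (𝓝 (x₀ i)) :=
    ((EuclideanSpace.proj (𝕜 := ℝ) i).continuous.tendsto x₀).comp hx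
  filter_upwards [ht.eventually_lt hxi hpos] with k hk hmem
  simp only [workSet, Finset.mem_filter, Finset.mem_univ, true_and] at hmem
  exact absurd hk (not_lt.2 hmem)

theorem tendsto_quadraticForm {κ ν : Type*} [Fintype κ] {l : Filter ν} {z : ν → κ → ℝ}
    {H : ν → Matrix κ κ ℝ} {d : κ → ℝ} {H₀ : Matrix κ κ ℝ} (hz : Tendsto z l (𝓝 d))
    (hH : Tendsto H l (𝓝 H₀)) :
    Tendsto (fun k => z k ⬝ᵥ (H k *ᵥ z k)) l (𝓝 (d ⬝ᵥ (H₀ *ᵥ d))) := by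
  have hcont : Continuous fun p : (κ → ℝ) × Matrix κ κ ℝ => p.1 ⬝ᵥ (p.2 *ᵥ p.1) :=
    continuous_fst.dotProduct (continuous_snd.matrix_mulVec continuous_fst)
  exact (hcont.tendsto (d, H₀)).comp (hz.prodMk_nhds hH)

/-- The limit of quadratic forms with lower bounds `-C ω` is nonnegative if `ω` becomes
arbitrarily small. -/
theorem quadraticForm_nonneg_of_frequently {κ ν : Type*} [Fintype κ] {l : Filter ν}
    {z : ν → κ → ℝ} {H : ν → Matrix κ κ ℝ} {d : κ → ℝ} {H₀ : Matrix κ κ ℝ} {C : ℝ}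
    (hz : Tendsto z l (𝓝 d)) (hH : Tendsto H l (𝓝 H₀))
    (h : ∀ ε > 0, ∃ᶠ k in l, -(C * ε * (∑ i, |z k i|) ^ 2) ≤ z k ⬝ᵥ (H k *ᵥ z k)) :
    0 ≤ d ⬝ᵥ (H₀ *ᵥ d) := by
  have hsum : Tendsto (fun k => (∑ i, |z k i|) ^ 2) l (𝓝 ((∑ i, |d i|) ^ 2)) :=
    (tendsto_finsetSum _ fun i _ => (tendsto_pi_nhds.1 hz i).abs).pow 2
  have hbound : ∀ ε > 0, -(C * ε * (∑ i, |d i|) ^ 2) ≤ d ⬝ᵥ (H₀ *ᵥ d) := by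
    intro ε hε
    have := ge_of_tendsto_of_frequently
      ((tendsto_quadraticForm hz hH).add (hsum.const_mul (C * ε)))
      ((h ε hε).mono fun k hk => neg_le_iff_add_nonneg.1 hk)
    exact neg_le_iff_add_nonneg.2 this
  have hlim : Tendsto (fun ε : ℝ => -(C * ε * (∑ i, |d i|) ^ 2)) (𝓝[>] 0) (𝓝 0) := by
    have hcont : Continuous fun ε : ℝ => -(C * ε * (∑ i, |d i|) ^ 2) := by fun_prop
    simpa using (hcont.tendsto 0).mono_left nhdsWithin_le_nhds
  exact le_of_tendsto hlim (eventually_nhdsWithin_of_forall hbound)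

end PdSQP

end

theorem mainTheorem1 {n m : ℕ} (f : PdSQP.E n → ℝ) (c : PdSQP.E n → PdSQP.E m)
    (hf : ContDiff ℝ 2 f) (hc : ContDiff ℝ 2 c)
    (r : PdSQP.Run f c) (σ : ℕ → ℕ) (hσ : StrictMono σ)
    (hSL : ∀ j, r.IsS (σ j) ∨ r.IsL (σ j))
    (xs : PdSQP.E n) (ys : PdSQP.E m)
    (hx : Tendsto (fun j => r.x (σ j)) atTop (𝓝 xs))
    (hy : Tendsto (fun j => r.y (σ j)) atTop (𝓝 ys))
    (hKKT : PdSQP.IsKKT f c xs ys)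
    (hMFCQ : PdSQP.MFCQ c xs) (hWCR : PdSQP.WCR c xs) :
    PdSQP.SecondOrderNecessary f c xs ys := by
  refine ⟨hKKT, fun d hJd hAd => ?_⟩
  -- Constant rank yields `z j → d` with `J(x) z j = 0` at the iterates and `z j` zero on the active
  -- set of `xs`, hence eventually on the estimated one.
  obtain ⟨z, hz, hz0⟩ := PdSQP.exists_tendsto_mulVec_eq_zero
    (((PdSQP.continuous_activeJac hc xs).tendsto xs).comp hx) (hx.eventually hWCR)
    ((PdSQP.activeJac_mulVec_eq_zero_iff c xs xs d).2 ⟨hJd, hAd⟩)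
  have hwork := PdSQP.eventually_workSet_active (r.tol_tendsto.comp hσ.tendsto_atTop) hx
    fun i => (hKKT.2 i).1
  -- The constant involves neither `j` nor `μ`, so the regularization parameters may behave
  -- arbitrarily.
  refine PdSQP.quadraticForm_nonneg_of_frequently
    (C := n * ((1 + (n + m) * max 1 r.Λ) ^ (n + m)) ^ 2 / (1 - r.θ)) hz (PdSQP.tendsto_lagHess hf hc hx hy) fun ε hε => ?_
  refine ((r.frequently_omega_le hσ hSL hε).and_eventually (hwork.and hz0)).mono ?_
  rintro j ⟨hω, hwj, hzj⟩
  have hzj' := (PdSQP.activeJac_mulVec_eq_zero_iff c xs (r.x (σ j)) (z j)).1 hzj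
  exact (r.u_spec (σ j)).neg_le_dotProduct (PdSQP.lagHess_isSymm hf hc _ _) (r.μ_pos _)
    r.θ_nonneg r.θ_lt_one hε.le ((PdSQP.neg_curvature_le_omega _ _ _ _ _ _).trans hω)
    (fun i hi => hzj'.2 i (hwj i hi)) hzj'.1
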